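/- Let $\mathbb{D}$ be the open unit disc and $dA=\frac1\pi\,dx\,dy$. Let $\omega\in\hat{\mathcal D}$, that is, $\omega$ is a positive integrable function on $(0,1)$, extended radially to $\mathbb{D}$ by $\omega(z)=\omega(|z|)$, for which there is a constant $C>0$ with $\hat\omega(r)<C\,\hat\omega\big(\frac{1+r}{2}\big)$ for all $0<r<1$, where $\hat\omega(r)=\int_r^1\omega(s)\,ds$. For $0<p<\infty$ let $A^p_\omega$ be the space of analytic functions $f$ on $\mathbb{D}$ with $\|f\|_{A^p_\omega}^p=\int_{\mathbb{D}}|f|^p\omega\,dA<\infty$. For $a\in\mathbb{D}\setminus\{0\}$ let $$S(a)=\Big\{re^{i\theta}:\ |a|\le r<1,\ |\arg(ae^{-i\theta})|\le\tfrac{1-|a|}{2}\Big\},$$ let $S(0)=\mathbb{D}$, let $\omega(S(a))=\int_{S(a)}\omega\,dA$, and for $\gamma>0$ put $$F_{a,p,\gamma}(z)=\Big(\frac{1-|a|^2}{1-\bar a z}\Big)^{\frac{\gamma+1}{p}}\frac{1}{\omega(S(a))^{1/p}},\qquad a,z\in\mathbb{D}.$$ **Theorem 1.** Let $\omega\in\hat{\mathcal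 D}$ and $0<p<\infty$. There is $\gamma_0>0$, depending only on $\omega$ and $p$, such that for every $\gamma>\gamma_0$ and every $q$ with $p\le q<\infty$ there is a constant $C>0$, depending only on $\omega,p,q,\gamma$, with the following property. For every measurable function $u:\mathbb{D}\to\mathbb{C}$, every analytic self-map $\varphi$ of $\mathbb{D}$ and every positive Borel measure $\mu$ on $\mathbb{D}$, the operator $uC_\varphi f=u\cdot(f\circ\varphi)$ satisfies $$\frac1C\,\sup_{a\in\mathbb{D}}\int_{\mathbb{D}}|F_{a,p,\gamma}(\varphi(z))|^q|u(z)|^q\,d\mu(z)\ \le\ \|uC_\varphi\|_{A^p_\omega\to L^q_\mu}^q\ \le\ C\,\sup_{a\in\mathbb{D}}\int_{\mathbb{D}}|F_{a,p,\gamma}(\varphi(z))|^q|u(z)|^q\,d\mu(z),$$ where $\|uC_\varphi\|_{A^p_\omega\to L^q_\mu}=\sup\{\|uC_\varphi f\|_{L^q_\mu}: f\in A^p_\omega,\ \|f\|_{A^p_\omega}\le1\}\in[0,\infty]$; both sides may be infinite, so in particular $uC_\varphi: A^p_\omega\to L^q_\mu$ is bounded if and only if the supremum over $a$ is finite. -/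

import Mathlib

open MeasureTheory Set
open scoped ENNReal NNReal

noncomputable section

namespace WeightedBergman

/-- The open unit disc, as a subset of the complex plane. -/
abbrev disc : Set ℂ := Metric.ball 0 1

/-- The tail integral of a radial weight: the integral of `ω` over `(r, 1)`. -/
def tail (ω : ℝ → ℝ) (r : ℝ) : ℝ := ∫ s in r..1, ω s

/-- A radial weight is given by its profile `ω` on `(0, 1)`; as a function on the disc it is
`z ↦ ω ‖z‖`. The weight is doubling if it is positive, integrable on `(0, 1)`, and its tail
integrals satisfy a doubling condition. -/
structure IsDoubling (ω : ℝ → ℝ) : Prop where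
  pos : ∀ r ∈ Ioo (0 : ℝ) 1, 0 < ω r
  integrable : IntegrableOn ω (Ioo 0 1)
  doubling : ∃ C : ℝ, 0 < C ∧ ∀ r ∈ Ioo (0 : ℝ) 1, tail ω r < C * tail ω ((1 + r) / 2)

/-- Normalized Lebesgue area measure on the disc. -/
def area : Measure ℂ := ENNReal.ofReal (Real.pi⁻¹) • (volume : Measure ℂ).restrict disc

/-- The measure `ω dA` on the disc. -/
def weighted (ω : ℝ → ℝ) : Measure ℂ := area.withDensity fun z => ENNReal.ofReal (ω ‖z‖)

/-- The (quasi-)norm of the weighted Bergman space, as an extended nonnegative number. -/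
def bergmanNorm (ω : ℝ → ℝ) (p : ℝ) (f : ℂ → ℂ) : ℝ≥0∞ :=
  eLpNorm f (ENNReal.ofReal p) (weighted ω)

/-- The weighted Bergman space: analytic functions on the disc with finite (quasi-)norm. -/
def bergmanSpace (ω : ℝ → ℝ) (p : ℝ) : Set (ℂ → ℂ) :=
  {f | DifferentiableOn ℂ f disc ∧ bergmanNorm ω p f < ∞}

/-- The Carleson square `S(a)`. For `a ≠ 0` it consists of the points `r e^{iθ}` with
`|a| ≤ r < 1` and `|arg (a e^{-iθ})| ≤ (1 - |a|) / 2`; note that the arc of all such `e^{iθ}` has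
length `1 - |a|`, and that `a * conj z` has the argument of `a e^{-iθ}` when `z = r e^{iθ}`, `r > 0`.
Moreover `S(0)` is the whole disc. -/
def carlesonSquare (a : ℂ) : Set ℂ :=
  if a = 0 then disc
  else {z | ‖a‖ ≤ ‖z‖ ∧ ‖z‖ < 1 ∧ |Complex.arg (a * starRingEnd ℂ z)| ≤ (1 - ‖a‖) / 2}

/-- The test function
`F_{a,p,γ}(z) = ((1 - |a|²) / (1 - conj a * z)) ^ ((γ + 1) / p) / ω(S(a)) ^ (1 / p)`
(principal branch: the base has positive real part for `a`, `z` in the disc). -/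
def testFun (ω : ℝ → ℝ) (p γ : ℝ) (a z : ℂ) : ℂ :=
  ((1 - (‖a‖ : ℂ) ^ 2) / (1 - starRingEnd ℂ a * z)) ^ (((γ + 1) / p : ℝ) : ℂ) *
    ((1 / (weighted ω (carlesonSquare a)).toReal ^ (1 / p) : ℝ) : ℂ)

/-- The weighted composition operator `u C_φ`. -/
def wcomp (u φ : ℂ → ℂ) (f : ℂ → ℂ) (z : ℂ) : ℂ := u z * f (φ z)

/-- The operator (quasi-)norm of `u C_φ : A^p_ω → L^q_μ`, with value `∞` if the operator is
unbounded. Only the restriction of `μ` to the disc matters. -/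
def wcompNorm (ω : ℝ → ℝ) (p q : ℝ) (μ : Measure ℂ) (u φ : ℂ → ℂ) : ℝ≥0∞ :=
  ⨆ f ∈ {f ∈ bergmanSpace ω p | bergmanNorm ω p f ≤ 1},
    eLpNorm (wcomp u φ f) (ENNReal.ofReal q) (μ.restrict disc)

/-- The supremum over `a` in the disc of `∫_𝔻 |F_{a,p,γ}(φ(z))|^q |u(z)|^q dμ(z)`. -/
def testSup (ω : ℝ → ℝ) (p q γ : ℝ) (μ : Measure ℂ) (u φ : ℂ → ℂ) : ℝ≥0∞ :=
  ⨆ a ∈ disc, ∫⁻ z in disc, ‖testFun ω p γ a (φ z)‖ₑ ^ q * ‖u z‖ₑ ^ q ∂μ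

end WeightedBergman

end

noncomputable section

namespace WeightedBergman

/-! Push the measure `|u|^q dμ` forward under `φ` to a measure `ν` on the disc. The two quantities
become the best constant in an embedding of `A^p_ω` into `L^q(ν)` and the supremum of `∫ |F_a|^q
dν`, so the theorem is a Carleson embedding theorem. Sizes are measured by `mass w t`, `t` times the
weight of the last stretch of radius `t`. It is comparable to `ω(S(a))` for `t = 1 - |a|`, and
doubling in `t`.

Test functions give one direction. The region around `a` at scale `2^k (1 - |a|)` has mass at most
`C^k` times the first one, while the kernel there is at most `2^(-k)`. A kernel power `N` with `2C ≤
2^N` makes the sum converge, so the `F_a` are uniformly bounded in `A^p_ω` (`lintegral_testFun_le`);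
this fixes the threshold for `γ`.

Conversely, `|F_b|` is bounded below by a constant times `ω(S(b))^(-1/p)` on a large disc about `b`.
Finiteness of the supremum therefore gives the Carleson condition `ν(disc about b) ≤ K mass^(q/p)`
(`pullbackMeasure_ball_le`).

The embedding follows from a maximal function argument applied to `|f|^s`, `s = p/2`. Subharmonicity
bounds `|f(a)|^s` by an average of `|f|^s`. The Poisson kernel is only bounded crudely, so an
analytic factor equal to 1 at `a` is inserted to supply `N` powers of decay
(`DoublingDensity.rpow_mul_mass_le`). Dyadic summation then bounds `|f(a)|^s` by the supremum of its
averages over discs containing `a` that reach the boundary. A Vitali covering, with `∑ x_i^r ≤ (∑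
x_i)^r` for `r = q/p ≥ 1`, gives a weak type estimate for `ν`; truncating `|f|^s` and integrating
over levels upgrades it to the strong estimate (`DoublingDensity.lintegral_rpow_le`). -/

/-! ### Polar coordinates and radial measures. -/

open Real in
lemma lintegral_area {F : ℂ → ℝ≥0∞} (hF : Measurable F) :
    ∫⁻ z, F z ∂area = ENNReal.ofReal π⁻¹ *
      ∫⁻ ρ in Ioo 0 1, ∫⁻ θ in Ioo (-π) π, ENNReal.ofReal ρ * F (circleMap 0 ρ θ) := by
  rw [area, lintegral_smul_measure, smul_eq_mul]
  congr 1
  rw [← lintegral_indicator Metric.isOpen_ball.measurableSet,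
    ← Complex.lintegral_comp_polarCoord_symm]
  have hcm : ∀ p : ℝ × ℝ, Complex.polarCoord.symm p = circleMap 0 p.1 p.2 := by
    intro p
    simp [circleMap, Complex.exp_mul_I]
  have hmeas : Measurable fun p : ℝ × ℝ => circleMap 0 p.1 p.2 := by
    unfold circleMap; fun_prop
  have hI : Measurable (disc.indicator F) := hF.indicator Metric.isOpen_ball.measurableSet
  simp only [hcm, smul_eq_mul, polarCoord_target]
  rw [Measure.volume_eq_prod, ← Measure.prod_restrict, lintegral_prod]
  · rw [← lintegral_indicator measurableSet_Ioi, ← lintegral_indicator measurableSet_Ioo]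
    refine lintegral_congr fun ρ => ?_
    by_cases h0 : 0 < ρ
    · by_cases h1 : ρ < 1
      · rw [indicator_of_mem (show ρ ∈ Ioi (0 : ℝ) from h0),
            indicator_of_mem (show ρ ∈ Ioo 0 1 from ⟨h0, h1⟩)]
        refine lintegral_congr fun θ => ?_
        rw [indicator_of_mem]
        simp [abs_of_pos h0, h1]
      · rw [indicator_of_mem (show ρ ∈ Ioi (0 : ℝ) from h0), indicator_of_notMem (fun h => h1 h.2)]
        rw [← lintegral_zero (μ := volume.restrict (Ioo (-π) π))]
        refine lintegral_congr fun θ => ?_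
        rw [indicator_of_notMem, mul_zero]
        simpa [abs_of_pos h0] using h1
    · rw [indicator_of_notMem (show ρ ∉ Ioi (0 : ℝ) from h0), indicator_of_notMem (fun h => h0 h.1)]
  · exact (((ENNReal.measurable_ofReal.comp measurable_fst).mul (hI.comp hmeas))).aemeasurable

/-- The radial measure on the disc with density `w ‖z‖` with respect to area measure. -/
def radial (w : ℝ → ℝ≥0∞) : Measure ℂ := area.withDensity fun z => w ‖z‖

open Real in
lemma lintegral_radial {w : ℝ → ℝ≥0∞} (hw : Measurable w) {F : ℂ → ℝ≥0∞} (hF : Measurable F) :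
    ∫⁻ z, F z ∂radial w = ENNReal.ofReal π⁻¹ *
      ∫⁻ ρ in Ioo 0 1, ENNReal.ofReal ρ * w ρ * ∫⁻ θ in Ioo (-π) π, F (circleMap 0 ρ θ) := by
  have hwn : Measurable fun z : ℂ => w ‖z‖ := hw.comp measurable_norm
  rw [radial, lintegral_withDensity_eq_lintegral_mul _ hwn hF, lintegral_area (hwn.mul hF)]
  congr 1
  refine setLIntegral_congr_fun measurableSet_Ioo fun ρ hρ => ?_
  have hc : Measurable fun θ : ℝ => F (circleMap 0 ρ θ) := by
    refine hF.comp ?_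
    unfold circleMap; fun_prop
  rw [← lintegral_const_mul _ hc]
  refine lintegral_congr fun θ => ?_
  simp [abs_of_pos hρ.1, mul_assoc]

lemma radial_compl_disc (w : ℝ → ℝ≥0∞) : radial w discᶜ = 0 := by
  refine withDensity_absolutelyContinuous _ _ ?_
  simp [area, Measure.restrict_apply Metric.isOpen_ball.measurableSet.compl]

lemma ae_mem_disc_radial (w : ℝ → ℝ≥0∞) : ∀ᵐ z ∂radial w, z ∈ disc :=
  radial_compl_disc w

/-- Lets the profile of a radial weight be changed on a null set of radii; `ω` itself is only almost
everywhere measurable. -/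
lemma area_norm_preimage_null {T : Set ℝ} (hT : volume T = 0) :
    area ((fun z : ℂ => ‖z‖) ⁻¹' T) = 0 := by
  obtain ⟨U, hTU, hU, hU0⟩ := exists_measurable_superset_of_null hT
  refine measure_mono_null (preimage_mono hTU) ?_
  have hm : MeasurableSet ((fun z : ℂ => ‖z‖) ⁻¹' U) := measurable_norm hU
  rw [← lintegral_indicator_one hm, lintegral_area (measurable_one.indicator hm)]
  have : ∀ᵐ ρ ∂(volume.restrict (Ioo (0 : ℝ) 1)), ρ ∉ U :=
    ae_restrict_of_ae (measure_eq_zero_iff_ae_notMem.mp hU0)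
  rw [lintegral_congr_ae (g := fun _ => 0)]
  · simp
  · filter_upwards [this, ae_restrict_mem measurableSet_Ioo] with ρ hρ hρ'
    rw [← lintegral_zero (μ := volume.restrict (Ioo (-Real.pi) Real.pi))]
    refine lintegral_congr fun θ => ?_
    rw [indicator_of_notMem, mul_zero]
    simpa [abs_of_pos hρ'.1] using hρ

/-- A measurable radial density representing the weight. -/
lemma exists_density {ω : ℝ → ℝ} (hω : IsDoubling ω) :
    ∃ w : ℝ → ℝ≥0∞, Measurable w ∧ weighted ω = radial w ∧
      ∀ r, 0 ≤ r → r ≤ 1 → ∫⁻ s in Ioo r 1, w s = ENNReal.ofReal (tail ω r) := by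
  have hae : AEMeasurable (fun r => ENNReal.ofReal (ω r)) (volume.restrict (Ioo (0 : ℝ) 1)) :=
    hω.integrable.aestronglyMeasurable.aemeasurable.ennreal_ofReal
  refine ⟨hae.mk, hae.measurable_mk, ?_, ?_⟩
  · refine withDensity_congr_ae ?_
    -- Radius 0 is added to the exceptional set because the profile is controlled only on the open
    -- interval.
    have h1 : volume ({r | ¬ (r ∈ Ioo (0 : ℝ) 1 → ENNReal.ofReal (ω r) = hae.mk _ r)} ∪ {0}) = 0 :=
        by
      refine measure_union_null ?_ (by simp)
      exact (ae_restrict_iff' measurableSet_Ioo).mp hae.ae_eq_mk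
    have h2 := measure_eq_zero_iff_ae_notMem.mp (area_norm_preimage_null h1)
    have h3 : ∀ᵐ z ∂area, z ∈ disc := by
      change area discᶜ = 0
      simp [area, Measure.restrict_apply Metric.isOpen_ball.measurableSet.compl]
    filter_upwards [h2, h3] with z hz hz'
    simp only [mem_preimage, mem_union, mem_ofPred_eq, not_or, not_not, mem_singleton_iff] at hz
    exact hz.1 ⟨lt_of_le_of_ne (norm_nonneg _) (Ne.symm hz.2), by simpa using hz'⟩
  · intro r hr hr1
    have hsub : Ioo r 1 ⊆ Ioo (0 : ℝ) 1 := Ioo_subset_Ioo_left hr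
    have hint : IntegrableOn ω (Ioo r 1) := hω.integrable.mono_set hsub
    rw [tail, intervalIntegral.integral_of_le hr1, integral_Ioc_eq_integral_Ioo,
      ofReal_integral_eq_lintegral_ofReal hint]
    · have h := ae_restrict_of_ae_restrict_of_subset hsub hae.ae_eq_mk
      exact lintegral_congr_ae (h.mono fun _ hx => hx.symm)
    · filter_upwards [ae_restrict_mem measurableSet_Ioo] with s hs
      exact (hω.pos s (hsub hs)).le

/-! ### Model sizes and their doubling property. -/

/-- The model size `t * ∫_{1-t}^1 w` of a Carleson region of width `t`. -/
def mass (w : ℝ → ℝ≥0∞) (t : ℝ) : ℝ≥0∞ :=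
  ENNReal.ofReal t * ∫⁻ s in Ioo (max 0 (1 - t)) 1, w s

/-- A measurable radial density whose model sizes are doubling, positive and finite. -/
structure DoublingDensity (w : ℝ → ℝ≥0∞) (C : ℝ≥0) : Prop where
  measurable : Measurable w
  one_le : 1 ≤ C
  mass_ne_zero : ∀ t, 0 < t → mass w t ≠ 0
  mass_ne_top : ∀ t, mass w t ≠ ∞
  doubling : ∀ t, 0 < t → mass w (2 * t) ≤ C * mass w t

lemma mass_mono (w : ℝ → ℝ≥0∞) {s t : ℝ} (h : s ≤ t) : mass w s ≤ mass w t := by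
  unfold mass
  gcongr

lemma DoublingDensity.mass_two_pow_le {w : ℝ → ℝ≥0∞} {C : ℝ≥0} (hw : DoublingDensity w C)
    {t : ℝ} (ht : 0 < t) (k : ℕ) : mass w (2 ^ k * t) ≤ C ^ k * mass w t := by
  induction k with
  | zero => simp
  | succ k ih =>
    calc mass w (2 ^ (k + 1) * t) = mass w (2 * (2 ^ k * t)) := by ring_nf
      _ ≤ C * mass w (2 ^ k * t) := hw.doubling _ (by positivity)
      _ ≤ C * (C ^ k * mass w t) := by gcongr
      _ = C ^ (k + 1) * mass w t := by ring

lemma tail_pos {ω : ℝ → ℝ} (hω : IsDoubling ω) {r : ℝ} (h0 : 0 ≤ r) (h1 : r < 1) :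
    0 < tail ω r := by
  have hsub : Ioo r 1 ⊆ Ioo (0 : ℝ) 1 := Ioo_subset_Ioo_left h0
  refine intervalIntegral.intervalIntegral_pos_of_pos_on ?_ (fun x hx => hω.pos x (hsub hx)) h1
  rw [intervalIntegrable_iff_integrableOn_Ioo_of_le h1.le]
  exact hω.integrable.mono_set hsub

lemma exists_doublingDensity {ω : ℝ → ℝ} (hω : IsDoubling ω) :
    ∃ (w : ℝ → ℝ≥0∞) (C : ℝ≥0), DoublingDensity w C ∧ weighted ω = radial w := by
  obtain ⟨w, hwm, hwr, hwt⟩ := exists_density hω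
  obtain ⟨C, hC, hdoub⟩ := hω.doubling
  have hI : ∀ t, 0 < t → ∫⁻ s in Ioo (max 0 (1 - t)) 1, w s =
      ENNReal.ofReal (tail ω (max 0 (1 - t))) := fun t ht =>
    hwt _ (le_max_left _ _) (max_le zero_le_one (by linarith))
  have hmass : ∀ t, 0 < t → mass w t = ENNReal.ofReal (t * tail ω (max 0 (1 - t))) := by
    intro t ht
    rw [mass, hI t ht, ENNReal.ofReal_mul ht.le]
  have htp : ∀ t, 0 < t → 0 < tail ω (max 0 (1 - t)) := fun t ht =>
    tail_pos hω (le_max_left _ _) (max_lt one_pos (by linarith))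
  have h0 := tail_pos hω le_rfl one_pos
  have h2 := tail_pos hω (r := 1 / 2) (by norm_num) (by norm_num)
  -- `C` serves the scales with `2t < 1`. For `2t ≥ 1` the doubled tail is the full integral, and
  -- the quotient compares it with the tail from `1/2`.
  set D : ℝ := C + tail ω 0 / tail ω (1 / 2) with hD
  have hD0 : 0 < D := by positivity
  have hanti : ∀ t, 1 / 2 ≤ t → tail ω (1 / 2) ≤ tail ω (max 0 (1 - t)) := by
    intro t ht
    rw [← ENNReal.ofReal_le_ofReal_iff (htp t (by linarith)).le, ← hI t (by linarith),
      ← hwt _ (by norm_num) (by norm_num)]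
    exact lintegral_mono_set (Ioo_subset_Ioo_left (max_le (by norm_num) (by linarith)))
  refine ⟨w, (2 * D + 1).toNNReal, ⟨hwm, ?_, ?_, ?_, ?_⟩, hwr⟩
  · rw [Real.le_toNNReal_iff_coe_le (by positivity)]
    push_cast; linarith
  · intro t ht
    rw [hmass t ht]
    have := htp t ht
    simp only [ne_eq, ENNReal.ofReal_eq_zero, not_le]
    positivity
  · intro t
    rcases le_or_gt t 0 with ht | ht
    · simp [mass, ENNReal.ofReal_of_nonpos ht]
    · rw [hmass t ht]; exact ENNReal.ofReal_ne_top
  · intro t ht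
    rw [hmass t ht, hmass (2 * t) (by positivity), ← ENNReal.ofReal.eq_1,
      ← ENNReal.ofReal_mul (by positivity)]
    refine ENNReal.ofReal_le_ofReal ?_
    have key : tail ω (max 0 (1 - 2 * t)) ≤ D * tail ω (max 0 (1 - t)) := by
      have hp := htp t ht
      rcases lt_or_ge (2 * t) 1 with h | h
      · rw [max_eq_right (by linarith), max_eq_right (by linarith)] at *
        have := (hdoub (1 - 2 * t) ⟨by linarith, by linarith⟩).le
        rw [show (1 + (1 - 2 * t)) / 2 = 1 - t by ring] at this
        refine this.trans ?_
        gcongr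
        rw [hD]
        have : 0 < tail ω 0 / tail ω (1 / 2) := by positivity
        linarith
      · rw [max_eq_left (by linarith)]
        calc tail ω 0 = tail ω 0 / tail ω (1 / 2) * tail ω (1 / 2) := by field_simp
          _ ≤ D * tail ω (max 0 (1 - t)) := by
            gcongr
            · linarith
            · exact hanti t (by linarith)
    have hp := htp t ht
    nlinarith [mul_pos ht hp, mul_le_mul_of_nonneg_left key ht.le]

/-! ### Measures of discs and Carleson squares. -/

lemma lintegral_radial_rotate {w : ℝ → ℝ≥0∞} (hw : Measurable w) {F : ℂ → ℝ≥0∞}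
    (hF : Measurable F) {c : ℂ} (hc : ‖c‖ = 1) :
    ∫⁻ z, F (c * z) ∂radial w = ∫⁻ z, F z ∂radial w := by
  have hwn : Measurable fun z : ℂ => w ‖z‖ := hw.comp measurable_norm
  have hFc : Measurable fun z => F (c * z) := hF.comp (measurable_const_mul c)
  rw [radial, lintegral_withDensity_eq_lintegral_mul _ hwn hFc,
    lintegral_withDensity_eq_lintegral_mul _ hwn hF, area, lintegral_smul_measure,
    lintegral_smul_measure]
  congr 1
  rw [← lintegral_indicator Metric.isOpen_ball.measurableSet,
    ← lintegral_indicator Metric.isOpen_ball.measurableSet]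
  have hmp : MeasurePreserving (rotation ⟨c, mem_sphere_zero_iff_norm.mpr hc⟩) :=
    LinearIsometryEquiv.measurePreserving _
  rw [← hmp.lintegral_comp ((hwn.mul hF).indicator Metric.isOpen_ball.measurableSet)]
  refine lintegral_congr fun z => ?_
  have : (rotation ⟨c, mem_sphere_zero_iff_norm.mpr hc⟩) z = c * z := rfl
  rw [this]
  by_cases hz : ‖z‖ < 1
  · rw [indicator_of_mem (by simpa using hz), indicator_of_mem (by simpa [hc] using hz)]
    simp [hc]
  · rw [indicator_of_notMem (by simpa using hz), indicator_of_notMem (by simpa [hc] using hz)]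

lemma radial_rotate {w : ℝ → ℝ≥0∞} (hw : Measurable w) {S : Set ℂ} (hS : MeasurableSet S)
    {c : ℂ} (hc : ‖c‖ = 1) : radial w ((fun z => c * z) ⁻¹' S) = radial w S := by
  rw [← lintegral_indicator_one hS, ← lintegral_radial_rotate hw (measurable_one.indicator hS) hc,
    ← lintegral_indicator_one (measurable_const_mul c hS)]
  rfl

open Real in
lemma radial_apply {w : ℝ → ℝ≥0∞} (hw : Measurable w) {S : Set ℂ} (hS : MeasurableSet S) :
    radial w S = ENNReal.ofReal π⁻¹ * ∫⁻ ρ in Ioo 0 1, ENNReal.ofReal ρ * w ρ *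
      volume ({θ | circleMap 0 ρ θ ∈ S} ∩ Ioo (-π) π) := by
  rw [← lintegral_indicator_one hS, lintegral_radial hw (measurable_one.indicator hS)]
  congr 1
  refine lintegral_congr fun ρ => ?_
  congr 1
  have hm : MeasurableSet {θ | circleMap 0 ρ θ ∈ S} := (by unfold circleMap; fun_prop : Measurable
      (circleMap 0 ρ)) hS
  rw [← Measure.restrict_apply hm, ← lintegral_indicator_one hm]
  rfl

-- After rotating `b` to the positive axis and writing `h = 1 - |b|`, a point `ρ e^{iθ}` of the ball
-- has `ρ > 1 - 4h` and `|e^{iθ} - 1| ≤ 8h`, so `|θ| ≤ 4πh` by Jordan's inequality. The ball thus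
-- lies in a polar box of scale `4h`, two doublings above `h`.
open Real in
lemma DoublingDensity.radial_ball_le {w : ℝ → ℝ≥0∞} {C : ℝ≥0} (hw : DoublingDensity w C)
    {b : ℂ} (hb : b ∈ disc) :
    radial w (Metric.ball b (3 * (1 - ‖b‖))) ≤ 8 * C ^ 2 * mass w (1 - ‖b‖) := by
  have hb1 : ‖b‖ < 1 := by simpa using hb
  set h := 1 - ‖b‖ with hh
  have hpos : 0 < h := by linarith
  obtain ⟨c, hc, hcb⟩ : ∃ c : ℂ, ‖c‖ = 1 ∧ b = c * ‖b‖ := by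
    rcases eq_or_ne b 0 with rfl | h0
    · exact ⟨1, by simp, by simp⟩
    · have : (‖b‖ : ℂ) ≠ 0 := by simpa using h0
      exact ⟨b / ‖b‖, by simp [h0], by field_simp⟩
  have hrot : (fun z => c * z) ⁻¹' Metric.ball b (3 * h) = Metric.ball (‖b‖ : ℂ) (3 * h) := by
    ext z
    simp only [mem_preimage, Metric.mem_ball, dist_eq_norm]
    conv_lhs => rw [hcb]
    rw [← mul_sub, norm_mul, hc, one_mul]
  rw [← radial_rotate hw.measurable Metric.isOpen_ball.measurableSet hc, hrot,
    radial_apply hw.measurable Metric.isOpen_ball.measurableSet]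
  have hang : ∀ ρ ∈ Ioo (0 : ℝ) 1, ∀ θ ∈ Ioo (-π) π,
      circleMap 0 ρ θ ∈ Metric.ball (‖b‖ : ℂ) (3 * h) → |θ| ≤ π * (4 * h) ∧ 1 - 4 * h < ρ := by
    intro ρ hρ θ hθ hz
    rw [Metric.mem_ball, dist_eq_norm] at hz
    have hn : ‖circleMap 0 ρ θ‖ = ρ := by simp [abs_of_pos hρ.1]
    have hρ4 : 1 - 4 * h < ρ := by
      have h1 : ‖b‖ - ρ ≤ ‖circleMap 0 ρ θ - (‖b‖ : ℂ)‖ := by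
        have := norm_sub_norm_le (‖b‖ : ℂ) (circleMap 0 ρ θ)
        rw [hn, norm_sub_rev] at this
        simpa using this
      linarith
    refine ⟨?_, hρ4⟩
    have hexp : ‖Complex.exp (Complex.I * θ) - 1‖ ≤ 8 * h := by
      have e1 : Complex.exp (Complex.I * θ) - 1 = (1 - ρ : ℝ) * Complex.exp (Complex.I * θ) +
          (circleMap 0 ρ θ - (‖b‖ : ℂ)) + ((‖b‖ - 1 : ℝ) : ℂ) := by
        simp only [circleMap, zero_add]
        push_cast
        rw [mul_comm Complex.I]
        ring
      have e2 : ‖Complex.exp (Complex.I * θ)‖ = 1 := by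
        rw [mul_comm]; exact Complex.norm_exp_ofReal_mul_I θ
      calc _ ≤ ‖((1 - ρ : ℝ) : ℂ) * Complex.exp (Complex.I * θ)‖ + ‖circleMap 0 ρ θ - (‖b‖ : ℂ)‖ +
            ‖((‖b‖ - 1 : ℝ) : ℂ)‖ := by rw [e1]; exact norm_add₃_le
        _ ≤ (1 - ρ) + 3 * h + h := by
          rw [norm_mul, e2, Complex.norm_real, Complex.norm_real, norm_eq_abs, norm_eq_abs,
            abs_of_pos (by linarith [hρ.2]), abs_of_neg (by linarith)]
          linarith
        _ ≤ 8 * h := by linarith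
    rw [Complex.norm_exp_I_mul_ofReal_sub_one, norm_mul, norm_eq_abs, norm_eq_abs, abs_two] at hexp
    have hjor := mul_abs_le_abs_sin (x := θ / 2) (by
      rw [abs_div, abs_two]
      have := abs_lt.mpr ⟨hθ.1, hθ.2⟩
      linarith)
    rw [abs_div, abs_two] at hjor
    have h3 : 2 / π * (|θ| / 2) ≤ 4 * h := by linarith
    have h4 : 2 / π * (|θ| / 2) = |θ| / π := by ring
    rw [h4, div_le_iff₀ pi_pos] at h3
    linarith
  calc _ ≤ ENNReal.ofReal π⁻¹ * ∫⁻ ρ in Ioo 0 1, (Ioo (max 0 (1 - 4 * h)) 1).indicator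
        (fun ρ => w ρ * ENNReal.ofReal (2 * (π * (4 * h)))) ρ := by
        gcongr ENNReal.ofReal π⁻¹ * ?_
        refine setLIntegral_mono' measurableSet_Ioo fun ρ hρ => ?_
        by_cases h4 : 1 - 4 * h < ρ
        · rw [indicator_of_mem (show ρ ∈ Ioo (max 0 (1 - 4 * h)) 1 from ⟨max_lt hρ.1 h4, hρ.2⟩)]
          have h1 : ENNReal.ofReal ρ ≤ 1 := ENNReal.ofReal_le_one.mpr hρ.2.le
          have h2 : volume ({θ | circleMap 0 ρ θ ∈ Metric.ball (‖b‖ : ℂ) (3 * h)} ∩ Ioo (-π) π) ≤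
              ENNReal.ofReal (2 * (π * (4 * h))) := by
            have : {θ | circleMap 0 ρ θ ∈ Metric.ball (‖b‖ : ℂ) (3 * h)} ∩ Ioo (-π) π ⊆
                Icc (-(π * (4 * h))) (π * (4 * h)) := fun θ hθ =>
              abs_le.mp (hang ρ hρ θ hθ.2 hθ.1).1
            refine (measure_mono this).trans ?_
            rw [Real.volume_Icc]
            exact ENNReal.ofReal_le_ofReal (by linarith)
          calc _ ≤ 1 * w ρ * ENNReal.ofReal (2 * (π * (4 * h))) := by gcongr
            _ = _ := by rw [one_mul]
        · have : {θ | circleMap 0 ρ θ ∈ Metric.ball (‖b‖ : ℂ) (3 * h)} ∩ Ioo (-π) π = ∅ := by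
            ext θ
            simp only [mem_inter_iff, mem_empty_iff_false, iff_false, not_and]
            exact fun hz hθ => h4 (hang ρ hρ θ hθ hz).2
          rw [this]; simp
    _ ≤ ENNReal.ofReal π⁻¹ * ((∫⁻ ρ in Ioo (max 0 (1 - 4 * h)) 1, w ρ) *
        ENNReal.ofReal (2 * (π * (4 * h)))) := by
        gcongr
        rw [← lintegral_mul_const _ hw.measurable, lintegral_indicator measurableSet_Ioo]
        exact lintegral_mono' (Measure.restrict_mono le_rfl Measure.restrict_le_self) le_rfl
    _ = 2 * mass w (2 ^ 2 * h) := by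
        rw [mass, mul_comm (∫⁻ ρ in _, w ρ), ← mul_assoc, ← mul_assoc,
            ← ENNReal.ofReal_mul (by positivity),
          show (2 : ℝ≥0∞) = ENNReal.ofReal 2 by simp,
          ← mul_assoc (ENNReal.ofReal 2), ← ENNReal.ofReal_mul zero_le_two]
        congr 2
        · field_simp
          ring
        · norm_num
    _ ≤ 2 * (C ^ 2 * mass w h) := by gcongr; exact hw.mass_two_pow_le hpos 2
    _ ≤ 8 * C ^ 2 * mass w h := by
        rw [mul_assoc]
        gcongr
        norm_num

lemma measurableSet_carlesonSquare (a : ℂ) : MeasurableSet (carlesonSquare a) := by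
  unfold carlesonSquare
  split_ifs
  · exact Metric.isOpen_ball.measurableSet
  · have h1 : Measurable fun z : ℂ => a * starRingEnd ℂ z := by fun_prop
    have h2 : Measurable fun z : ℂ => Complex.arg (a * starRingEnd ℂ z) :=
      Complex.measurable_arg.comp h1
    have h3 : Measurable fun z : ℂ => |Complex.arg (a * starRingEnd ℂ z)| :=
      continuous_abs.measurable.comp h2
    exact (measurableSet_le measurable_const measurable_norm).inter
      ((measurableSet_lt measurable_norm measurable_const).inter
        (measurableSet_le h3 measurable_const))

/-- The angular width of the Carleson square at a point of modulus `r`. -/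
def squareWidth (r : ℝ) : ℝ := if r = 0 then 2 * Real.pi else 1 - r

open Real in
lemma radial_carlesonSquare {w : ℝ → ℝ≥0∞} (hw : Measurable w) {a : ℂ} (ha : a ∈ disc) :
    radial w (carlesonSquare a) = ENNReal.ofReal π⁻¹ * (ENNReal.ofReal (squareWidth ‖a‖) *
      ∫⁻ ρ in Ioo ‖a‖ 1, ENNReal.ofReal ρ * w ρ) := by
  have hmw : Measurable fun ρ => ENNReal.ofReal ρ * w ρ := ENNReal.measurable_ofReal.mul hw
  rcases eq_or_ne a 0 with rfl | h0
  · have : carlesonSquare 0 = disc := by simp [carlesonSquare]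
    rw [this, radial_apply hw Metric.isOpen_ball.measurableSet, norm_zero,
        mul_comm (ENNReal.ofReal (squareWidth 0)),
      ← lintegral_mul_const _ hmw]
    congr 1
    refine setLIntegral_congr_fun measurableSet_Ioo fun ρ hρ => ?_
    have : {θ | circleMap 0 ρ θ ∈ disc} = univ := by
      ext θ; simp [abs_of_pos hρ.1, hρ.2]
    simp only [this, univ_inter, Real.volume_Ioo, squareWidth, if_true]
    congr 2; ring
  · have ha1 : ‖a‖ < 1 := by simpa using ha
    have hna : 0 < ‖a‖ := norm_pos_iff.mpr h0
    have hnc : (‖a‖ : ℂ) ≠ 0 := by exact_mod_cast hna.ne'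
    have hc : ‖a / ‖a‖‖ = 1 := by simp [h0]
    rw [← radial_rotate hw (measurableSet_carlesonSquare a) hc,
      radial_apply hw (measurable_const_mul _ (measurableSet_carlesonSquare a))]
    congr 1
    rw [mul_comm (ENNReal.ofReal (squareWidth _)), ← lintegral_mul_const _ hmw]
    have hset : ∀ ρ ∈ Ioo (0 : ℝ) 1,
        ‖a‖ ≤ ρ → {θ | circleMap 0 ρ θ ∈ (fun z => a / ‖a‖ * z) ⁻¹' carlesonSquare a} ∩ Ioo (-π) π
        = Icc (-((1 - ‖a‖) / 2)) ((1 - ‖a‖) / 2) := by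
      intro ρ hρ hle
      have key : ∀ θ ∈ Ioo (-π) π, Complex.arg (a * starRingEnd ℂ (a / ‖a‖ * circleMap 0 ρ θ)) = -θ
          := by
        intro θ hθ
        have : a * starRingEnd ℂ (a / ‖a‖ * circleMap 0 ρ θ) =
            (‖a‖ * ρ : ℝ) * (Complex.cos (-θ : ℝ) + Complex.sin (-θ : ℝ) * Complex.I) := by
          simp only [circleMap, zero_add, map_mul, map_div₀, Complex.conj_ofReal,
              ← Complex.exp_conj, Complex.conj_I]
          rw [← Complex.exp_mul_I]
          push_cast
          have : a * starRingEnd ℂ a = (‖a‖ : ℂ) ^ 2 := Complex.mul_conj' a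
          have h2 : a * (starRingEnd ℂ a / ‖a‖ * (ρ * Complex.exp (θ * -Complex.I))) =
            (a * starRingEnd ℂ a) / ‖a‖ * (ρ * Complex.exp (-θ * Complex.I)) := by
            rw [neg_mul, mul_neg]; ring
          rw [h2, this]
          field_simp
        rw [this, Complex.arg_mul_cos_add_sin_mul_I (mul_pos hna hρ.1) ⟨by linarith [hθ.2],
            by linarith [hθ.1]⟩]
      ext θ
      simp only [mem_inter_iff, mem_ofPred_eq, mem_preimage, carlesonSquare, h0, if_false]
      constructor
      · rintro ⟨⟨-, -, h3⟩, hθ⟩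
        rw [key θ hθ, abs_neg, abs_le] at h3
        exact h3
      · intro h3
        have hpi := pi_gt_three
        have hθ : θ ∈ Ioo (-π) π := ⟨by linarith [h3.1], by linarith [h3.2]⟩
        refine ⟨⟨?_, ?_, ?_⟩, hθ⟩
        · simpa [h0, abs_of_pos hρ.1] using hle
        · simpa [h0, abs_of_pos hρ.1] using hρ.2
        · rw [key θ hθ, abs_neg, abs_le]
          exact h3
    have hempty : ∀ ρ ∈ Ioo (0 : ℝ) 1, ¬ ‖a‖ ≤ ρ →
        {θ | circleMap 0 ρ θ ∈ (fun z => a / ‖a‖ * z) ⁻¹' carlesonSquare a} = ∅ := by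
      intro ρ hρ hle
      ext θ
      simp only [mem_ofPred_eq, mem_preimage, carlesonSquare, h0, if_false, mem_empty_iff_false,
          iff_false]
      rintro ⟨h1, -⟩
      apply hle
      simpa [h0, abs_of_pos hρ.1] using h1
    have hIco : ∫⁻ ρ in Ioo ‖a‖ 1, ENNReal.ofReal ρ * w ρ * ENNReal.ofReal (squareWidth ‖a‖) =
        ∫⁻ ρ in Ico ‖a‖ 1, ENNReal.ofReal ρ * w ρ * ENNReal.ofReal (squareWidth ‖a‖) := by
      rw [setLIntegral_congr Ioo_ae_eq_Ico]
    rw [hIco, ← lintegral_indicator measurableSet_Ioo, ← lintegral_indicator measurableSet_Ico]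
    refine lintegral_congr fun ρ => ?_
    by_cases hρ : ρ ∈ Ioo (0 : ℝ) 1
    · rw [indicator_of_mem hρ]
      by_cases hle : ‖a‖ ≤ ρ
      · rw [indicator_of_mem (show ρ ∈ Ico ‖a‖ 1 from ⟨hle, hρ.2⟩), hset ρ hρ hle,
            Real.volume_Icc, squareWidth, if_neg hna.ne']
        congr 2; ring
      · rw [indicator_of_notMem (fun h => hle h.1), hempty ρ hρ hle]; simp
    · rw [indicator_of_notMem hρ, indicator_of_notMem (fun h => hρ ⟨hna.trans_le h.1, h.2⟩)]

open Real in
lemma DoublingDensity.radial_carlesonSquare_le {w : ℝ → ℝ≥0∞} {C : ℝ≥0} (hw : DoublingDensity w C)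
    {a : ℂ} (ha : a ∈ disc) : radial w (carlesonSquare a) ≤ 2 * mass w (1 - ‖a‖) := by
  have ha1 : ‖a‖ < 1 := by simpa using ha
  rw [radial_carlesonSquare hw.measurable ha, mass, ← mul_assoc, ← mul_assoc, sub_sub_cancel,
      max_eq_right (norm_nonneg a)]
  gcongr ?_ * ?_
  · rw [← ENNReal.ofReal_mul (by positivity), ← ENNReal.ofReal_ofNat 2,
        ← ENNReal.ofReal_mul (by positivity)]
    refine ENNReal.ofReal_le_ofReal ?_
    unfold squareWidth
    have hpi := pi_gt_three
    split_ifs with h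
    · rw [h]; field_simp; norm_num
    · have : π⁻¹ ≤ 1 := inv_le_one_of_one_le₀ (by linarith)
      nlinarith
  · refine setLIntegral_mono' measurableSet_Ioo fun ρ hρ => ?_
    calc _ ≤ 1 * w ρ := by gcongr; exact ENNReal.ofReal_le_one.mpr hρ.2.le
      _ = w ρ := one_mul _

-- The only loss is the polar factor `ρ`, which is small near the origin. Radii at least `1/2`
-- suffice: for `|a| < 1/2`, one doubling step recovers the mass from them.
open Real in
lemma DoublingDensity.mass_le_radial_carlesonSquare {w : ℝ → ℝ≥0∞} {C : ℝ≥0}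
    (hw : DoublingDensity w C) {a : ℂ} (ha : a ∈ disc) :
    mass w (1 - ‖a‖) ≤ 16 * C * radial w (carlesonSquare a) := by
  have ha1 : ‖a‖ < 1 := by simpa using ha
  have hpi := pi_gt_three
  have hpi4 := pi_le_four
  have hhalf : mass w (1 - ‖a‖) ≤ 2 * (C * (ENNReal.ofReal (1 - ‖a‖) * ∫⁻ s in Ioo (max ‖a‖ (1 /
      2)) 1, w s)) := by
    have hC : (1 : ℝ≥0∞) ≤ C := by exact_mod_cast hw.one_le
    rcases le_or_gt (1 / 2) ‖a‖ with h | h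
    · rw [max_eq_left h, mass, sub_sub_cancel, max_eq_right (norm_nonneg a)]
      calc _ = 1 * (1 * (ENNReal.ofReal (1 - ‖a‖) * ∫⁻ s in Ioo ‖a‖ 1, w s)) := by simp
        _ ≤ _ := by gcongr; norm_num
    · rw [max_eq_right h.le]
      calc mass w (1 - ‖a‖) ≤ mass w (2 * (1 / 2)) := mass_mono _ (by linarith [norm_nonneg a])
        _ ≤ C * mass w (1 / 2) := hw.doubling _ (by norm_num)
        _ ≤ C * (ENNReal.ofReal (1 - ‖a‖) * ∫⁻ s in Ioo (1 / 2) 1, w s) := by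
          rw [mass, show max 0 (1 - 1 / 2 : ℝ) = 1 / 2 by norm_num]
          gcongr
          linarith
        _ ≤ _ := by
          conv_lhs => rw [← one_mul ((C : ℝ≥0∞) * _)]
          gcongr; norm_num
  have hint : ∫⁻ s in Ioo (max ‖a‖ (1 / 2)) 1, w s ≤ 2 * ∫⁻ ρ in Ioo ‖a‖ 1,
      ENNReal.ofReal ρ * w ρ := by
    have hm : Measurable fun ρ => ENNReal.ofReal ρ * w ρ :=
      ENNReal.measurable_ofReal.mul hw.measurable
    rw [← lintegral_const_mul _ hm]
    refine le_trans ?_ (lintegral_mono_set (Ioo_subset_Ioo_left (le_max_left _ (1 / 2))))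
    refine setLIntegral_mono' measurableSet_Ioo fun ρ hρ => ?_
    have : (1 : ℝ≥0∞) ≤ 2 * ENNReal.ofReal ρ := by
      rw [← ENNReal.ofReal_ofNat 2, ← ENNReal.ofReal_mul (by positivity), ENNReal.one_le_ofReal]
      linarith [(max_lt_iff.mp hρ.1).2]
    calc w ρ = 1 * w ρ := (one_mul _).symm
      _ ≤ 2 * ENNReal.ofReal ρ * w ρ := by gcongr
      _ = _ := by rw [mul_assoc]
  rw [radial_carlesonSquare hw.measurable ha]
  calc mass w (1 - ‖a‖) ≤ 2 * (C * (ENNReal.ofReal (1 - ‖a‖) * (2 * ∫⁻ ρ in Ioo ‖a‖ 1,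
      ENNReal.ofReal ρ * w ρ))) := by
        refine hhalf.trans ?_
        gcongr
    _ = C * (ENNReal.ofReal (4 * (1 - ‖a‖)) * ∫⁻ ρ in Ioo ‖a‖ 1, ENNReal.ofReal ρ * w ρ) := by
        rw [ENNReal.ofReal_mul (by norm_num), ENNReal.ofReal_ofNat,
            show (4 : ℝ≥0∞) = 2 * 2 by norm_num]
        ring
    _ ≤ C * (ENNReal.ofReal (16 * (π⁻¹ * squareWidth ‖a‖)) * ∫⁻ ρ in Ioo ‖a‖ 1,
        ENNReal.ofReal ρ * w ρ) := by
        refine mul_le_mul' le_rfl (mul_le_mul' (ENNReal.ofReal_le_ofReal ?_) le_rfl)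
        unfold squareWidth
        split_ifs with h
        · rw [h]; field_simp; norm_num
        · have : 1 / 4 ≤ π⁻¹ := by rw [one_div]; gcongr
          nlinarith
    _ = _ := by
        rw [ENNReal.ofReal_mul (by norm_num), ENNReal.ofReal_mul (by positivity),
            ENNReal.ofReal_ofNat]
        ring

/-! ### Vitali covering estimate. -/

/-- The open disc about `b` of radius three times the distance from `b` to the unit circle. -/
def region (b : ℂ) : Set ℂ := Metric.ball b (3 * (1 - ‖b‖))

lemma tsum_rpow_le_rpow_tsum {ι : Type*} (f : ι → ℝ≥0∞) {r : ℝ} (hr : 1 ≤ r) :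
    ∑' i, f i ^ r ≤ (∑' i, f i) ^ r := by
  have hsplit : ∀ x : ℝ≥0∞, x ^ r = x * x ^ (r - 1) := by
    intro x
    conv_lhs => rw [show r = 1 + (r - 1) by ring]
    rw [ENNReal.rpow_add_of_nonneg _ _ zero_le_one (by linarith), ENNReal.rpow_one]
  calc ∑' i, f i ^ r ≤ ∑' i, f i * (∑' j, f j) ^ (r - 1) := by
        refine ENNReal.tsum_le_tsum fun i => ?_
        rw [hsplit]
        exact mul_le_mul' le_rfl
          (ENNReal.rpow_le_rpow (ENNReal.le_tsum i) (by linarith))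
    _ = (∑' i, f i) ^ r := by rw [ENNReal.tsum_mul_right, ← hsplit]

/-- Covering estimate of weak type for a measure dominated by a power of the model sizes. -/
lemma measure_le_of_forall_exists_region {w : ℝ → ℝ≥0∞}
    {m ν : Measure ℂ} {K : ℝ≥0∞} {r : ℝ} (hr : 1 ≤ r)
    (hν : ∀ b ∈ disc, ν (Metric.ball b (12 * (1 - ‖b‖))) ≤ K * mass w (1 - ‖b‖) ^ r)
    {g : ℂ → ℝ≥0∞} {l : ℝ≥0∞} (hl : l ≠ 0) (hl' : l ≠ ∞) {E : Set ℂ}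
    (hE : ∀ z ∈ E, ∃ b ∈ disc, z ∈ region b ∧ l * mass w (1 - ‖b‖) ≤ ∫⁻ ζ in region b, g ζ ∂m) :
    ν E ≤ K * (l⁻¹ * ∫⁻ ζ, g ζ ∂m) ^ r := by
  set t : Set ℂ := {b ∈ disc | l * mass w (1 - ‖b‖) ≤ ∫⁻ ζ in region b, g ζ ∂m} with ht
  -- Enlarging radii `3(1 - |b|)` by the Vitali factor 4 produces the radii `12(1 - |b|)` in the
  -- hypothesis on `ν`.
  obtain ⟨u, hut, hdisj, hcov⟩ := Vitali.exists_disjoint_subfamily_covering_enlargement_ball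
    t id (fun b => 3 * (1 - ‖b‖)) 3 (fun b _ => by linarith [norm_nonneg b]) 4 (by norm_num)
  have hpos : ∀ b ∈ t, 0 < 1 - ‖b‖ := by
    intro b hb
    have : ‖b‖ < 1 := by simpa using hb.1
    linarith
  have hcount : u.Countable := hdisj.countable_of_isOpen (fun _ _ => Metric.isOpen_ball)
    (fun b hb => Metric.nonempty_ball.mpr (by have := hpos b (hut hb); positivity))
  have hsub : E ⊆ ⋃ b ∈ u, Metric.ball b (12 * (1 - ‖b‖)) := by
    intro z hz
    obtain ⟨b, hb, hzb, hle⟩ := hE z hz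
    obtain ⟨b', hb', hs⟩ := hcov b ⟨hb, hle⟩
    refine mem_iUnion₂.mpr ⟨b', hb', ?_⟩
    have := hs hzb
    simp only [id] at this
    rwa [show 4 * (3 * (1 - ‖b'‖)) = 12 * (1 - ‖b'‖) by ring] at this
  have := hcount.to_subtype
  calc ν E ≤ ν (⋃ b ∈ u, Metric.ball b (12 * (1 - ‖b‖))) := measure_mono hsub
    _ ≤ ∑' b : u, ν (Metric.ball (b : ℂ) (12 * (1 - ‖(b : ℂ)‖))) := measure_biUnion_le ν hcount _
    _ ≤ ∑' b : u, K * mass w (1 - ‖(b : ℂ)‖) ^ r :=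
        ENNReal.tsum_le_tsum fun b => hν b (hut b.2).1
    _ = K * ∑' b : u, mass w (1 - ‖(b : ℂ)‖) ^ r := ENNReal.tsum_mul_left
    _ ≤ K * (∑' b : u, mass w (1 - ‖(b : ℂ)‖)) ^ r := by
        gcongr; exact tsum_rpow_le_rpow_tsum _ hr
    _ ≤ K * (∑' b : u, l⁻¹ * ∫⁻ ζ in region b, g ζ ∂m) ^ r := by
        gcongr with b
        rw [← ENNReal.div_eq_inv_mul, ENNReal.le_div_iff_mul_le (Or.inl hl) (Or.inl hl'), mul_comm]
        exact (hut b.2).2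
    _ = K * (l⁻¹ * ∫⁻ ζ in ⋃ b ∈ u, region b, g ζ ∂m) ^ r := by
        rw [ENNReal.tsum_mul_left, ← lintegral_biUnion (s := region) hcount
          (fun _ _ => Metric.isOpen_ball.measurableSet) hdisj]
    _ ≤ K * (l⁻¹ * ∫⁻ ζ, g ζ ∂m) ^ r := by
        gcongr
        exact Measure.restrict_le_self

/-! ### Dyadic summation of kernel averages. -/

/-- The decaying kernel `(1 - |a|) / |1 - conj a * z|`. -/
def decay (a z : ℂ) : ℝ := (1 - ‖a‖) / ‖1 - starRingEnd ℂ a * z‖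

lemma one_sub_norm_le {a z : ℂ} (hz : z ∈ disc) :
    1 - ‖a‖ ≤ ‖1 - starRingEnd ℂ a * z‖ := by
  have hz1 : ‖z‖ < 1 := by simpa using hz
  have h1 := norm_sub_norm_le (1 : ℂ) (starRingEnd ℂ a * z)
  rw [norm_one, norm_mul, RCLike.norm_conj] at h1
  nlinarith [norm_nonneg a]

lemma decay_nonneg {a z : ℂ} (ha : a ∈ disc) : 0 ≤ decay a z := by
  have : ‖a‖ < 1 := by simpa using ha
  exact div_nonneg (by linarith) (norm_nonneg _)

lemma norm_sub_le_norm_one_sub {a z : ℂ} (ha : a ∈ disc) (hz : z ∈ disc) :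
    ‖z - a‖ ≤ ‖1 - starRingEnd ℂ a * z‖ := by
  have ha1 : ‖a‖ < 1 := by simpa using ha
  have hz1 : ‖z‖ < 1 := by simpa using hz
  refine le_of_sq_le_sq ?_ (norm_nonneg _)
  have key : ‖1 - starRingEnd ℂ a * z‖ ^ 2 - ‖z - a‖ ^ 2 = (1 - ‖a‖ ^ 2) * (1 - ‖z‖ ^ 2) := by
    simp only [← Complex.normSq_eq_norm_sq, Complex.normSq_apply]
    simp
    ring
  have h1 : 0 ≤ 1 - ‖a‖ ^ 2 := by nlinarith [norm_nonneg a]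
  have h2 : 0 ≤ 1 - ‖z‖ ^ 2 := by nlinarith [norm_nonneg z]
  nlinarith [mul_nonneg h1 h2]

/-- Take `b` on the radius through `a` with `1 - |b| = t`. Then `|z - b| ≤ |z - a| + |a - b| < 2t +
t`, which is why regions have radius three times the distance to the circle. For `t > 1` or `a = 0`,
the centre `b = 0` works since its region contains the disc. -/
lemma exists_region_of_scale {a : ℂ} (ha : a ∈ disc) {t : ℝ} (ht : 1 - ‖a‖ ≤ t) :
    ∃ b ∈ disc, 1 - ‖b‖ ≤ t ∧ a ∈ region b ∧
      ∀ z ∈ disc, ‖1 - starRingEnd ℂ a * z‖ < 2 * t → z ∈ region b := by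
  have ha1 : ‖a‖ < 1 := by simpa using ha
  have ht0 : 0 < t := by linarith
  rcases lt_or_ge 1 t with h | h
  · refine ⟨0, by simp, by simpa using h.le, by simp [region]; linarith, fun z hz _ => ?_⟩
    have : ‖z‖ < 1 := by simpa using hz
    simp [region]; linarith
  · rcases eq_or_ne a 0 with rfl | h0
    · refine ⟨0, by simp, by simpa using ht, by simp [region], fun z hz _ => ?_⟩
      have : ‖z‖ < 1 := by simpa using hz
      simp [region]; linarith
    have hna : 0 < ‖a‖ := norm_pos_iff.mpr h0
    set b : ℂ := ((1 - t) / ‖a‖ : ℝ) * a with hb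
    have hnb : ‖b‖ = 1 - t := by
      rw [hb, norm_mul, Complex.norm_real, Real.norm_of_nonneg (by apply div_nonneg <;> linarith)]
      field_simp
    have hab : ‖a - b‖ ≤ t - (1 - ‖a‖) := by
      have : a - b = ((1 - (1 - t) / ‖a‖ : ℝ) : ℂ) * a := by rw [hb]; push_cast; ring
      rw [this, norm_mul, Complex.norm_real, Real.norm_of_nonneg]
      · field_simp; linarith
      · rw [sub_nonneg, div_le_one hna]; linarith
    have hr : 3 * (1 - ‖b‖) = 3 * t := by rw [hnb]; ring
    refine ⟨b, by simp [hnb]; linarith, by rw [hnb]; linarith, ?_, fun z hz hlt => ?_⟩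
    · rw [region, Metric.mem_ball, dist_eq_norm, hr]; linarith
    · rw [region, Metric.mem_ball, dist_eq_norm, hr]
      have h1 := norm_sub_le_norm_one_sub ha hz
      have h2 : ‖z - b‖ ≤ ‖z - a‖ + ‖a - b‖ := norm_sub_le_norm_sub_add_norm_sub z a b
      linarith

/-- Kernel averages are controlled by the averages over the regions containing the point. -/
lemma lintegral_decay_pow_le {w : ℝ → ℝ≥0∞} {C : ℝ≥0} (hw : DoublingDensity w C) {N : ℕ}
    (hN : 2 * (C : ℝ≥0∞) ≤ 2 ^ N) {m : Measure ℂ} (hm : ∀ᵐ z ∂m, z ∈ disc) {g : ℂ → ℝ≥0∞}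
    (hg : Measurable g) {a : ℂ} (ha : a ∈ disc) {l : ℝ≥0∞}
    (hl : ∀ b ∈ disc, a ∈ region b → ∫⁻ z in region b, g z ∂m ≤ l * mass w (1 - ‖b‖)) :
    ∫⁻ z, g z * ENNReal.ofReal (decay a z ^ N) ∂m ≤ 2 * l * mass w (1 - ‖a‖) := by
  have ha1 : ‖a‖ < 1 := by simpa using ha
  set h := 1 - ‖a‖ with hh
  have hpos : 0 < h := by linarith
  have hex : ∀ k : ℕ, ∃ b ∈ disc, 1 - ‖b‖ ≤ 2 ^ k * h ∧ a ∈ region b ∧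
      ∀ z ∈ disc, ‖1 - starRingEnd ℂ a * z‖ < 2 * (2 ^ k * h) → z ∈ region b := fun k =>
    exists_region_of_scale ha (le_mul_of_one_le_left hpos.le (one_le_pow₀ one_le_two))
  choose b hb hbt hab hreg using hex
  have hpt : ∀ z ∈ disc, ENNReal.ofReal (decay a z ^ N) ≤
      ∑' k : ℕ, ((2 : ℝ≥0∞) ^ (k * N))⁻¹ * (region (b k)).indicator 1 z := by
    intro z hz
    have hle := one_sub_norm_le (a := a) hz
    -- `k` is the dyadic shell of `z`: there the kernel is at most `2^(-k)`, and `z` lies in the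
    -- `k`-th region.
    obtain ⟨k, hk1, hk2⟩ := exists_nat_pow_near (x := ‖1 - starRingEnd ℂ a * z‖ / h) (y := (2 : ℝ))
      (by rw [le_div_iff₀ hpos]; linarith) one_lt_two
    rw [le_div_iff₀ hpos] at hk1
    rw [div_lt_iff₀ hpos] at hk2
    refine le_trans ?_ (ENNReal.le_tsum k)
    rw [indicator_of_mem (hreg k z hz (by rw [pow_succ] at hk2; linarith)), Pi.one_apply, mul_one]
    have h2 : decay a z ≤ (2 ^ k)⁻¹ := by
      have : 0 < ‖1 - starRingEnd ℂ a * z‖ := by linarith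
      rw [decay, div_le_iff₀ this, inv_mul_eq_div, le_div_iff₀ (by positivity)]
      linarith
    calc ENNReal.ofReal (decay a z ^ N) ≤ ENNReal.ofReal (((2 ^ k)⁻¹) ^ N) := by
          gcongr
          exact decay_nonneg ha
      _ = ((2 : ℝ≥0∞) ^ (k * N))⁻¹ := by
          rw [inv_pow, ← pow_mul, ENNReal.ofReal_inv_of_pos (by positivity),
              ENNReal.ofReal_pow (by norm_num)]
          simp
  calc ∫⁻ z, g z * ENNReal.ofReal (decay a z ^ N) ∂m
      ≤ ∫⁻ z, ∑' k : ℕ, ((2 : ℝ≥0∞) ^ (k * N))⁻¹ * (region (b k)).indicator g z ∂m := by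
        refine lintegral_mono_ae ?_
        filter_upwards [hm] with z hz
        calc _ ≤ g z * ∑' k : ℕ, ((2 : ℝ≥0∞) ^ (k * N))⁻¹ * (region (b k)).indicator 1 z := by
              gcongr; exact hpt z hz
          _ = _ := by
              rw [← ENNReal.tsum_mul_left]
              refine tsum_congr fun k => ?_
              by_cases hz : z ∈ region (b k) <;> simp [hz, mul_comm]
    _ = ∑' k : ℕ, ((2 : ℝ≥0∞) ^ (k * N))⁻¹ * ∫⁻ z in region (b k), g z ∂m := by
        have hmr : ∀ k, MeasurableSet (region (b k)) := fun k => Metric.isOpen_ball.measurableSet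
        rw [lintegral_tsum fun k => ((hg.indicator (hmr k)).const_mul _).aemeasurable]
        refine tsum_congr fun k => ?_
        rw [lintegral_const_mul _ (hg.indicator (hmr k)), lintegral_indicator (hmr k)]
    _ ≤ ∑' k : ℕ, ((2 : ℝ≥0∞)⁻¹) ^ k * (l * mass w h) := by
        refine ENNReal.tsum_le_tsum fun k => ?_
        have h1 : ∫⁻ z in region (b k), g z ∂m ≤ l * (C ^ k * mass w h) := by
          refine (hl (b k) (hb k) (hab k)).trans ?_
          gcongr
          exact (mass_mono w (hbt k)).trans (hw.mass_two_pow_le hpos k)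
        -- The choice of `N` beats the growth `C^k` of the masses and leaves a geometric series.
        have h2 : ((2 : ℝ≥0∞) ^ (k * N))⁻¹ * C ^ k ≤ (2⁻¹) ^ k := by
          rw [mul_comm k N, pow_mul, ENNReal.inv_pow, ENNReal.inv_pow, ← mul_pow, ← ENNReal.inv_pow]
          gcongr
          rw [← ENNReal.div_eq_inv_mul]
          refine ENNReal.div_le_of_le_mul ?_
          calc (C : ℝ≥0∞) = 2⁻¹ * (2 * C) := by
                rw [← mul_assoc, ENNReal.inv_mul_cancel two_ne_zero ENNReal.ofNat_ne_top, one_mul]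
            _ ≤ 2⁻¹ * 2 ^ N := by gcongr
        calc _ ≤ ((2 : ℝ≥0∞) ^ (k * N))⁻¹ * (l * (C ^ k * mass w h)) := by gcongr
          _ = (((2 : ℝ≥0∞) ^ (k * N))⁻¹ * C ^ k) * (l * mass w h) := by ring
          _ ≤ _ := by gcongr
    _ = 2 * l * mass w h := by
        rw [ENNReal.tsum_mul_right, ENNReal.tsum_geometric, ENNReal.one_sub_inv_two, inv_inv,
            mul_assoc]

/-! ### Subharmonicity of `|f|^s` with an analytic weight. -/

/-- The canonical factor is the inverse of a Blaschke factor, so removing a zero with it can only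
increase the modulus inside the disc. -/
lemma one_le_norm_canonicalFactor {R : ℝ} {u z : ℂ} (hu : u ∈ Metric.ball 0 R)
    (hz : z ∈ Metric.closedBall 0 R) (hne : z ≠ u) : 1 ≤ ‖Complex.canonicalFactor R u z‖ := by
  rw [mem_ball_zero_iff] at hu
  rw [mem_closedBall_zero_iff] at hz
  have hR : 0 < R := (norm_nonneg u).trans_lt hu
  have hzu : 0 < ‖z - u‖ := norm_pos_iff.mpr (sub_ne_zero.mpr hne)
  rw [Complex.canonicalFactor_apply, norm_div, norm_mul, Complex.norm_real,
      Real.norm_of_nonneg hR.le,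
    one_le_div (by positivity)]
  refine le_of_sq_le_sq ?_ (norm_nonneg _)
  have key : ‖(R : ℂ) ^ 2 - starRingEnd ℂ u * z‖ ^ 2 - (R * ‖z - u‖) ^ 2 =
      (R ^ 2 - ‖u‖ ^ 2) * (R ^ 2 - ‖z‖ ^ 2) := by
    rw [mul_pow, ← Complex.ofReal_pow]
    simp only [← Complex.normSq_eq_norm_sq, Complex.normSq_apply]
    simp [-Complex.ofReal_pow]
    ring
  have h1 : 0 ≤ R ^ 2 - ‖u‖ ^ 2 := by nlinarith [norm_nonneg u]
  have h2 : 0 ≤ R ^ 2 - ‖z‖ ^ 2 := by nlinarith [norm_nonneg z]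
  nlinarith [mul_nonneg h1 h2]

/-- Division by a finite Blaschke product: a function analytic on a closed disc without zeros on
the boundary circle is dominated by a zero-free one with the same modulus on the circle. -/
lemma exists_zeroFree_majorant {R : ℝ} (hR : 0 < R) {f : ℂ → ℂ}
    (hf : AnalyticOnNhd ℂ f (Metric.closedBall 0 R)) (hs : ∀ z ∈ Metric.sphere (0 : ℂ) R, f z ≠ 0)
    {a : ℂ} (ha : a ∈ Metric.ball 0 R) (hfa : f a ≠ 0) :
    ∃ h : ℂ → ℂ, AnalyticOnNhd ℂ h (Metric.closedBall 0 R) ∧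
      (∀ z ∈ Metric.closedBall (0 : ℂ) R, h z ≠ 0) ∧
      (∀ z ∈ Metric.sphere (0 : ℂ) R, ‖h z‖ = ‖f z‖) ∧ ‖f a‖ ≤ ‖h a‖ := by
  have ha' := Metric.ball_subset_closedBall ha
  have hord0 : ∀ z ∈ Metric.closedBall (0 : ℂ) R, f z ≠ 0 → meromorphicOrderAt f z = 0 := by
    intro z hz hfz
    rw [(hf z hz).meromorphicNFAt.meromorphicOrderAt_eq_zero_iff]
    exact hfz
  have hord : ∀ u : Metric.closedBall (0 : ℂ) R, meromorphicOrderAt f u ≠ ⊤ := by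
    rw [← hf.meromorphicOn.exists_meromorphicOrderAt_ne_top_iff_forall
      (Metric.isConnected_closedBall hR.le)]
    exact ⟨⟨a, ha'⟩, by simp [hord0 a ha' hfa]⟩
  obtain ⟨h, D⟩ := hf.meromorphicOn.exists_ecanonicalDecomp hord
  have hdiv : ∀ i, MeromorphicOn.divisor f (Metric.sphere 0 R) i = 0 := by
    intro i
    by_cases hi : i ∈ Metric.sphere (0 : ℂ) R
    · rw [MeromorphicOn.divisor_apply (hf.meromorphicOn.mono_set Metric.sphere_subset_closedBall)
          hi,
        hord0 i (Metric.sphere_subset_closedBall hi) (hs i hi)]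
      rfl
    · exact Function.locallyFinsuppWithin.apply_eq_zero_of_notMem _ hi
  -- Off the zeros, `log |h|` is `log |f|` plus one term per zero, counted with multiplicity. These
  -- terms vanish on the circle and are nonnegative inside.
  have hlog : ∀ z ∈ Metric.closedBall (0 : ℂ) R, f z ≠ 0 → Real.log ‖h z‖ =
      (∑ᶠ i, (MeromorphicOn.divisor f (Metric.ball 0 R) i) *
        Real.log ‖Complex.canonicalFactor R i z‖) + Real.log ‖f z‖ := by
    intro z hz hfz
    rw [D.log_norm_eq hz (hord0 z hz hfz) hR,
      (hf z hz).meromorphicTrailingCoeffAt_of_ne_zero hfz]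
    simp [hdiv]
  refine ⟨h, D.analyticOnNhd, D.ne_zero, fun z hz => ?_, ?_⟩
  · have hz' := Metric.sphere_subset_closedBall hz
    refine Real.log_injOn_pos (norm_pos_iff.mpr (D.ne_zero z hz')) (norm_pos_iff.mpr (hs z hz)) ?_
    rw [hlog z hz' (hs z hz), add_eq_right]
    refine finsum_eq_zero_of_forall_eq_zero fun i => ?_
    by_cases hi : i ∈ Metric.ball (0 : ℂ) R
    · rw [Complex.norm_canonicalFactor_eval_circle_eq_one hi hz, Real.log_one, mul_zero]
    · rw [Function.locallyFinsuppWithin.apply_eq_zero_of_notMem _ hi, Int.cast_zero, zero_mul]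
  · rw [← Real.log_le_log_iff (norm_pos_iff.mpr hfa) (norm_pos_iff.mpr (D.ne_zero a ha')),
      hlog a ha' hfa]
    refine le_add_of_nonneg_left (finsum_nonneg fun i => ?_)
    by_cases hi : i ∈ Metric.ball (0 : ℂ) R
    · have hnn : 0 ≤ MeromorphicOn.divisor f (Metric.ball 0 R) i :=
        MeromorphicOn.AnalyticOnNhd.divisor_nonneg (hf.mono Metric.ball_subset_closedBall) i
      refine mul_nonneg (by exact_mod_cast hnn) ?_
      -- At its own pole the factor has the default value 0, whose real logarithm is 0.
      rcases eq_or_ne a i with rfl | hne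
      · simp
      · exact Real.log_nonneg (one_le_norm_canonicalFactor hi ha' hne)
    · rw [Function.locallyFinsuppWithin.apply_eq_zero_of_notMem _ hi, Int.cast_zero, zero_mul]

/-- An analytic real power of a zero-free function, in terms of its modulus. -/
lemma exists_analytic_norm_eq_rpow {R : ℝ} (hR : 0 < R) {h : ℂ → ℂ}
    (hh : AnalyticOnNhd ℂ h (Metric.closedBall 0 R))
    (h0 : ∀ z ∈ Metric.closedBall (0 : ℂ) R, h z ≠ 0) (s : ℝ) :
    ∃ G : ℂ → ℂ, AnalyticOnNhd ℂ G (Metric.closedBall 0 R) ∧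
      ∀ z ∈ Metric.closedBall (0 : ℂ) R, ‖G z‖ = ‖h z‖ ^ s := by
  have hharm : InnerProductSpace.HarmonicOnNhd (fun z => Real.log ‖h z‖) (Metric.closedBall 0 R) :=
    fun z hz => (hh z hz).harmonicAt_log_norm (h0 z hz)
  -- By compactness `log |h|` is harmonic on a slightly larger disc, where it is the real part of an
  -- analytic `F`; the power is `exp (s F)`.
  obtain ⟨e, he, hsub⟩ := (isCompact_closedBall (0 : ℂ) R).exists_thickening_subset_open
    (InnerProductSpace.isOpen_setOfPred_harmonicAt fun z => Real.log ‖h z‖) hharm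
  rw [thickening_closedBall he hR.le] at hsub
  obtain ⟨F, hF, hFre⟩ := InnerProductSpace.HarmonicOnNhd.exists_analyticOnNhd_ball_re_eq hsub
  have hss : Metric.closedBall (0 : ℂ) R ⊆ Metric.ball 0 (e + R) :=
    Metric.closedBall_subset_ball (by linarith)
  refine ⟨fun z => Complex.exp (s * F z), fun z hz => ?_, fun z hz => ?_⟩
  · exact (analyticAt_const.mul (hF z (hss hz))).cexp
  · have hre : (F z).re = Real.log ‖h z‖ := hFre (hss hz)
    rw [Complex.norm_exp, Complex.re_ofReal_mul, hre,
        Real.rpow_def_of_pos (norm_pos_iff.mpr (h0 z hz)),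
      mul_comm]

/-- Subharmonicity of `|f| ^ s` against the Poisson kernel and an analytic weight `K`. -/
lemma norm_rpow_le_circleAverage {R : ℝ} (hR : 0 < R) {f : ℂ → ℂ}
    (hf : AnalyticOnNhd ℂ f (Metric.closedBall 0 R)) (hs : ∀ z ∈ Metric.sphere (0 : ℂ) R, f z ≠ 0)
    {K : ℂ → ℂ} (hK : AnalyticOnNhd ℂ K (Metric.closedBall 0 R))
    {a : ℂ} (ha : a ∈ Metric.ball 0 R) (hfa : f a ≠ 0) (s : ℝ) (hs0 : 0 ≤ s) :
    ENNReal.ofReal (‖f a‖ ^ s * ‖K a‖) ≤ ENNReal.ofReal (2 * Real.pi)⁻¹ *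
      ∫⁻ θ in Ioo (-Real.pi) Real.pi, ENNReal.ofReal (|poissonKernel 0 a (circleMap 0 R θ)| *
        (‖f (circleMap 0 R θ)‖ ^ s * ‖K (circleMap 0 R θ)‖)) := by
  -- Replacing `f` by a zero-free majorant makes the real power analytic, so the Poisson formula
  -- applies to its product with `K`. The boundary modulus is unchanged and the value at `a` only
  -- grows.
  obtain ⟨h, hh, h0, hsph, hfa'⟩ := exists_zeroFree_majorant hR hf hs ha hfa
  obtain ⟨G, hG, hGn⟩ := exists_analytic_norm_eq_rpow hR hh h0 s
  have hGK : DiffContOnCl ℂ (fun z => G z * K z) (Metric.ball 0 R) := by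
    refine DifferentiableOn.diffContOnCl ?_
    rw [closure_ball _ hR.ne']
    exact fun z hz => ((hG z hz).mul (hK z hz)).differentiableAt.differentiableWithinAt
  have hP := hGK.circleAverage_poissonKernel_smul ha
  rw [Real.circleAverage_eq_integral_add (-Real.pi), intervalIntegral.integral_comp_add_right
    (fun θ => (poissonKernel 0 a • fun z => G z * K z) (circleMap 0 R θ)), zero_add,
    show 2 * Real.pi + -Real.pi = Real.pi by ring,
    intervalIntegral.integral_of_le (by linarith [Real.pi_pos]), integral_Ioc_eq_integral_Ioo] at hP
  have ha' := Metric.ball_subset_closedBall ha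
  calc ENNReal.ofReal (‖f a‖ ^ s * ‖K a‖) ≤ ENNReal.ofReal ‖G a * K a‖ := by
        rw [norm_mul, hGn a ha']
        gcongr
    _ = ‖G a * K a‖ₑ := ofReal_norm _
    _ ≤ ENNReal.ofReal (2 * Real.pi)⁻¹ * ∫⁻ θ in Ioo (-Real.pi) Real.pi,
        ‖(poissonKernel 0 a • fun z => G z * K z) (circleMap 0 R θ)‖ₑ := by
        rw [← hP, enorm_smul, Real.enorm_of_nonneg (by positivity)]
        gcongr
        exact enorm_integral_le_lintegral_enorm _
    _ = _ := by
        congr 1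
        refine lintegral_congr fun θ => ?_
        have hz : circleMap 0 R θ ∈ Metric.sphere (0 : ℂ) R := circleMap_mem_sphere _ hR.le _
        rw [← ofReal_norm, Pi.smul_apply', norm_smul, norm_mul,
          hGn _ (Metric.sphere_subset_closedBall hz), hsph _ hz, Real.norm_eq_abs]

/-! ### Pointwise bounds by averages, and the weak type estimate. -/

/-- The zeros form a discrete, hence countable, set, so their moduli are a null set of radii. -/
lemma ae_radius_ne_zero {f : ℂ → ℂ} (hf : DifferentiableOn ℂ f disc) {a : ℂ} (ha : a ∈ disc)
    (hfa : f a ≠ 0) :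
    ∀ᵐ R : ℝ, R ∈ Ioo (0 : ℝ) 1 → ∀ z ∈ Metric.sphere (0 : ℂ) R, f z ≠ 0 := by
  have han : AnalyticOnNhd ℂ f disc := hf.analyticOnNhd Metric.isOpen_ball
  have hcod := han.preimage_zero_mem_codiscreteWithin hfa ha
    (Metric.isConnected_ball one_pos)
  have hdisc : IsDiscrete ((f ⁻¹' {0}ᶜ)ᶜ ∩ disc) := isDiscrete_of_codiscreteWithin (by simpa using
      hcod)
  have hcount := (HereditarilyLindelofSpace.isLindelof _).countable_of_isDiscrete hdisc
  have hnull : volume ((fun z : ℂ => ‖z‖) '' ((f ⁻¹' {0}ᶜ)ᶜ ∩ disc)) = 0 := (hcount.image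
      _).measure_zero _
  filter_upwards [measure_eq_zero_iff_ae_notMem.mp hnull] with R hR hR' z hz h0
  rw [mem_sphere_zero_iff_norm] at hz
  exact hR ⟨z, ⟨by simpa using h0, by simpa [hz] using hR'.2⟩, hz⟩

lemma abs_poissonKernel_le {a z : ℂ} (ha : a ∈ disc) (hz : z ∈ disc) (hza : (1 + ‖a‖) / 2 ≤ ‖z‖) :
    |poissonKernel 0 a z| ≤ 8 / (1 - ‖a‖) := by
  have ha1 : ‖a‖ < 1 := by simpa using ha
  have hz1 : ‖z‖ < 1 := by simpa using hz
  have h1 : (1 - ‖a‖) / 2 ≤ ‖z - a‖ := by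
    have := norm_sub_norm_le z a
    linarith
  have hpos : 0 < 1 - ‖a‖ := by linarith
  have h2 : 0 ≤ ‖z‖ ^ 2 - ‖a‖ ^ 2 := by nlinarith [norm_nonneg a]
  have h0 : 0 < ‖z - a‖ := by linarith
  rw [poissonKernel_def]
  simp only [sub_zero]
  rw [abs_div, abs_of_nonneg h2, abs_of_nonneg (by positivity),
      div_le_div_iff₀ (by positivity) hpos]
  have h3 : ((1 - ‖a‖) / 2) ^ 2 ≤ ‖z - a‖ ^ 2 := by gcongr
  have h4 : ‖z‖ ^ 2 - ‖a‖ ^ 2 ≤ 2 * (1 - ‖a‖) := by nlinarith [norm_nonneg a, norm_nonneg z]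
  calc (‖z‖ ^ 2 - ‖a‖ ^ 2) * (1 - ‖a‖) ≤ 2 * (1 - ‖a‖) * (1 - ‖a‖) := by gcongr
    _ ≤ 8 * ‖z - a‖ ^ 2 := by nlinarith

lemma one_sub_conj_mul_ne_zero {a z : ℂ} (ha : a ∈ disc) (hz : z ∈ disc) :
    1 - starRingEnd ℂ a * z ≠ 0 := by
  have ha1 : ‖a‖ < 1 := by simpa using ha
  have := one_sub_norm_le (a := a) hz
  exact norm_pos_iff.mp (by linarith)

/-- Pointwise control of `|f| ^ s` by kernel averages. -/
lemma DoublingDensity.rpow_mul_mass_le {w : ℝ → ℝ≥0∞} {C : ℝ≥0} (hw : DoublingDensity w C)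
    {f : ℂ → ℂ} (hf : DifferentiableOn ℂ f disc) (hfm : Measurable f) {s : ℝ} (hs : 0 < s) (N : ℕ)
    {a : ℂ} (ha : a ∈ disc) :
    ENNReal.ofReal (‖f a‖ ^ s) * mass w (1 - ‖a‖) ≤ 4 * 2 ^ N * C *
      ∫⁻ z, ENNReal.ofReal (‖f z‖ ^ s) * ENNReal.ofReal (decay a z ^ N) ∂radial w := by
  rcases eq_or_ne (f a) 0 with hfa | hfa
  · simp [hfa, Real.zero_rpow hs.ne']
  have ha1 : ‖a‖ < 1 := by simpa using ha
  have hna := norm_nonneg a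
  set h := 1 - ‖a‖ with hh
  have hpos : 0 < h := by linarith
  set Φ : ℂ → ℝ≥0∞ := fun z => ENNReal.ofReal (‖f z‖ ^ s) * ENNReal.ofReal (decay a z ^ N) with hΦ
  have hΦm : Measurable Φ := by
    have : Measurable (decay a) := by unfold decay; fun_prop
    fun_prop
  have han : AnalyticOnNhd ℂ f disc := hf.analyticOnNhd Metric.isOpen_ball
  -- Radii above `1 - h/2 = (1 + |a|)/2` keep the circle at distance at least `h/2` from `a`, so the
  -- Poisson kernel is at most `8/h`. One doubling step later restores the mass at scale `h`.
  have hcircle : ∀ᵐ R : ℝ, R ∈ Ioo (1 - h / 2) 1 → ENNReal.ofReal (‖f a‖ ^ s) * ENNReal.ofReal h ≤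
      ENNReal.ofReal (2 * Real.pi)⁻¹ * (8 * 2 ^ N *
        ∫⁻ θ in Ioo (-Real.pi) Real.pi, Φ (circleMap 0 R θ)) := by
    filter_upwards [ae_radius_ne_zero hf ha hfa] with R hR hRI
    have hR0 : 0 < R := by linarith [hRI.1]
    have hsub : Metric.closedBall (0 : ℂ) R ⊆ disc := Metric.closedBall_subset_ball hRI.2
    -- This weight equals 1 at `a` and its modulus is at most `2^N` times the `N`-th power of the
    -- decaying kernel.
    have hK : AnalyticOnNhd ℂ (fun z => ((1 - (‖a‖ : ℂ) ^ 2) / (1 - starRingEnd ℂ a * z)) ^ N)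
        (Metric.closedBall 0 R) := by
      intro z hz
      refine AnalyticAt.pow (analyticAt_const.div (by fun_prop) ?_) N
      exact one_sub_conj_mul_ne_zero ha (hsub hz)
    have haR : a ∈ Metric.ball (0 : ℂ) R := by
      rw [mem_ball_zero_iff]; linarith [hRI.1]
    have hKa : ((1 - (‖a‖ : ℂ) ^ 2) / (1 - starRingEnd ℂ a * a)) ^ N = 1 := by
      rw [Complex.conj_mul', div_self, one_pow]
      rw [← Complex.conj_mul']
      exact one_sub_conj_mul_ne_zero ha ha
    have hmain := norm_rpow_le_circleAverage hR0 (han.mono hsub) (hR ⟨hR0,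
        hRI.2⟩) hK haR hfa s hs.le
    rw [hKa, norm_one, mul_one] at hmain
    refine (mul_le_mul' hmain (le_refl (ENNReal.ofReal h))).trans ?_
    rw [mul_assoc]
    refine mul_le_mul' le_rfl ?_
    rw [← lintegral_mul_const' _ _ ENNReal.ofReal_ne_top,
        ← lintegral_const_mul' _ _ (by finiteness)]
    refine lintegral_mono fun θ => ?_
    set z := circleMap 0 R θ with hz
    have hzn : ‖z‖ = R := by simp [hz, abs_of_pos hR0]
    have hzd : z ∈ disc := by simpa [hzn] using hRI.2
    have hP := abs_poissonKernel_le ha hzd (by rw [hzn]; linarith [hRI.1])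
    have hKz : ‖((1 - (‖a‖ : ℂ) ^ 2) / (1 - starRingEnd ℂ a * z)) ^ N‖ ≤ 2 ^ N * decay a z ^ N := by
      rw [norm_pow, norm_div, ← mul_pow]
      have h1 : ‖(1 - (‖a‖ : ℂ) ^ 2)‖ ≤ 2 * (1 - ‖a‖) := by
        rw [← Complex.ofReal_one, ← Complex.ofReal_pow, ← Complex.ofReal_sub, Complex.norm_real,
          Real.norm_of_nonneg (by nlinarith)]
        nlinarith
      gcongr
      rw [decay, ← mul_div_assoc]
      gcongr
    have hd := decay_nonneg (z := z) ha
    simp only [hΦ]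
    rw [← ENNReal.ofReal_mul (by positivity), ← ENNReal.ofReal_mul (by positivity),
      show (8 : ℝ≥0∞) * 2 ^ N = ENNReal.ofReal (8 * 2 ^ N) by
        rw [ENNReal.ofReal_mul (by norm_num), ENNReal.ofReal_pow (by norm_num)]; simp,
      ← ENNReal.ofReal_mul (by positivity)]
    refine ENNReal.ofReal_le_ofReal ?_
    calc _ ≤ 8 / (1 - ‖a‖) * (‖f z‖ ^ s * (2 ^ N * decay a z ^ N)) * h := by gcongr
      _ = _ := by
        rw [← hh]; field_simp
  have hint : ENNReal.ofReal (‖f a‖ ^ s) * ENNReal.ofReal h * ∫⁻ ρ in Ioo (1 - h / 2) 1, w ρ ≤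
      ENNReal.ofReal (2 * Real.pi)⁻¹ * (8 * 2 ^ N) * (2 * ∫⁻ ρ in Ioo 0 1, ENNReal.ofReal ρ * w ρ *
        ∫⁻ θ in Ioo (-Real.pi) Real.pi, Φ (circleMap 0 ρ θ)) := by
    rw [← lintegral_const_mul _ hw.measurable, ← lintegral_const_mul' _ _ (by finiteness),
      ← lintegral_const_mul' _ _ (by finiteness)]
    refine le_trans ?_ (lintegral_mono_set (Ioo_subset_Ioo_left (show 0 ≤ 1 - h / 2 by linarith)))
    refine lintegral_mono_ae ((ae_restrict_iff' measurableSet_Ioo).mpr ?_)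
    filter_upwards [hcircle] with ρ hρ hρI
    have h2 : (1 : ℝ≥0∞) ≤ 2 * ENNReal.ofReal ρ := by
      rw [show (2 : ℝ≥0∞) = ENNReal.ofReal 2 by simp, ← ENNReal.ofReal_mul (by positivity),
        ENNReal.one_le_ofReal]
      linarith [hρI.1]
    calc ENNReal.ofReal (‖f a‖ ^ s) * ENNReal.ofReal h * w ρ
        ≤ ENNReal.ofReal (2 * Real.pi)⁻¹ * (8 * 2 ^ N *
          ∫⁻ θ in Ioo (-Real.pi) Real.pi, Φ (circleMap 0 ρ θ)) * (2 * ENNReal.ofReal ρ * w ρ) := by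
          refine mul_le_mul' (hρ hρI) ?_
          conv_lhs => rw [← one_mul (w ρ)]
          gcongr
      _ = _ := by ring
  calc ENNReal.ofReal (‖f a‖ ^ s) * mass w h
      ≤ ENNReal.ofReal (‖f a‖ ^ s) * (C * mass w (h / 2)) := by
        gcongr
        have := hw.doubling (h / 2) (by positivity)
        rwa [mul_div_cancel₀ h (two_ne_zero)] at this
    _ ≤ ENNReal.ofReal (‖f a‖ ^ s) * (C * (2⁻¹ * (ENNReal.ofReal h *
          ∫⁻ ρ in Ioo (1 - h / 2) 1, w ρ))) := by
        rw [mass, max_eq_right (by linarith), ENNReal.ofReal_div_of_pos two_pos,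
            ENNReal.ofReal_ofNat,
          ENNReal.div_eq_inv_mul, mul_assoc]
    _ = 2⁻¹ * C * (ENNReal.ofReal (‖f a‖ ^ s) * ENNReal.ofReal h *
          ∫⁻ ρ in Ioo (1 - h / 2) 1, w ρ) := by ring
    _ ≤ 2⁻¹ * C * (ENNReal.ofReal (2 * Real.pi)⁻¹ * (8 * 2 ^ N) * (2 * ∫⁻ ρ in Ioo 0 1,
          ENNReal.ofReal ρ * w ρ * ∫⁻ θ in Ioo (-Real.pi) Real.pi,
              Φ (circleMap 0 ρ θ))) := by gcongr
    _ = 4 * 2 ^ N * C * ∫⁻ z, Φ z ∂radial w := by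
        rw [lintegral_radial hw.measurable hΦm, mul_inv, ENNReal.ofReal_mul (by positivity),
          ENNReal.ofReal_inv_of_pos two_pos, ENNReal.ofReal_ofNat]
        have h22 : (2 : ℝ≥0∞)⁻¹ * 2 = 1 := ENNReal.inv_mul_cancel two_ne_zero ENNReal.ofNat_ne_top
        have h8 : (2 : ℝ≥0∞)⁻¹ * 8 = 4 := by
          rw [show (8 : ℝ≥0∞) = 2 * 4 by norm_num, ← mul_assoc, h22, one_mul]
        set X := ∫⁻ ρ in Ioo 0 1, ENNReal.ofReal ρ * w ρ *
          ∫⁻ θ in Ioo (-Real.pi) Real.pi, Φ (circleMap 0 ρ θ)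
        calc _ = (2⁻¹ * 8) * (2⁻¹ * 2) * (2 ^ N * C * (ENNReal.ofReal Real.pi⁻¹ * X)) := by ring
          _ = _ := by rw [h8, h22]; ring

/-- If all averages of `|f| ^ s` over regions containing `a` are at most `l`, then so is
`|f a| ^ s`, up to a constant. -/
lemma DoublingDensity.rpow_le_of_forall_region {w : ℝ → ℝ≥0∞} {C : ℝ≥0} (hw : DoublingDensity w C)
    {f : ℂ → ℂ} (hf : DifferentiableOn ℂ f disc) (hfm : Measurable f) {s : ℝ} (hs : 0 < s) {N : ℕ}
    (hN : 2 * (C : ℝ≥0∞) ≤ 2 ^ N) {a : ℂ} (ha : a ∈ disc) {l : ℝ≥0∞}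
    (hl : ∀ b ∈ disc, a ∈ region b →
      ∫⁻ z in region b, ENNReal.ofReal (‖f z‖ ^ s) ∂radial w ≤ l * mass w (1 - ‖b‖)) :
    ENNReal.ofReal (‖f a‖ ^ s) ≤ 8 * 2 ^ N * C * l := by
  have ha1 : ‖a‖ < 1 := by simpa using ha
  have h1 := hw.rpow_mul_mass_le hf hfm hs N ha
  have h2 := lintegral_decay_pow_le hw hN (ae_mem_disc_radial w)
    (by fun_prop : Measurable fun z => ENNReal.ofReal (‖f z‖ ^ s)) ha hl
  refine (ENNReal.mul_le_mul_iff_left (hw.mass_ne_zero (1 - ‖a‖) (by linarith))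
    (hw.mass_ne_top _)).mp ?_
  calc _ ≤ _ := h1
    _ ≤ 4 * 2 ^ N * C * (2 * l * mass w (1 - ‖a‖)) := by gcongr
    _ = _ := by ring

/-- Level sets of `|f| ^ s` have small measure for every measure dominated by the model sizes. -/
lemma DoublingDensity.measure_superlevel_le {w : ℝ → ℝ≥0∞} {C : ℝ≥0} (hw : DoublingDensity w C)
    {f : ℂ → ℂ} (hf : DifferentiableOn ℂ f disc) (hfm : Measurable f) {s : ℝ} (hs : 0 < s) {N : ℕ}
    (hN : 2 * (C : ℝ≥0∞) ≤ 2 ^ N) {ν : Measure ℂ} (hν0 : ν discᶜ = 0) {K : ℝ≥0∞} {r : ℝ}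
    (hr : 1 ≤ r)
    (hν : ∀ b ∈ disc, ν (Metric.ball b (12 * (1 - ‖b‖))) ≤ K * mass w (1 - ‖b‖) ^ r)
    {l : ℝ} (hl : 0 < l) :
    ν {z | l < ‖f z‖ ^ s / (8 * 2 ^ N * C)} ≤ K * ((ENNReal.ofReal (l / 2))⁻¹ *
      ∫⁻ z in {z | l / (16 * C ^ 2) < ‖f z‖ ^ s}, ENNReal.ofReal (‖f z‖ ^ s) ∂radial w) ^ r := by
  have hC : (1 : ℝ) ≤ C := by exact_mod_cast hw.one_le
  set A : ℝ := 8 * 2 ^ N * C with hA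
  have hApos : 0 < A := by positivity
  set T : Set ℂ := {z | l / (16 * C ^ 2) < ‖f z‖ ^ s} with hT
  have hTm : MeasurableSet T := measurableSet_lt measurable_const (by fun_prop)
  set G : ℂ → ℝ≥0∞ := fun z => ENNReal.ofReal (‖f z‖ ^ s) with hG
  have hGm : Measurable G := by fun_prop
  have hle : ν {z | l < ‖f z‖ ^ s / A} ≤ ν ({z | l < ‖f z‖ ^ s / A} ∩ disc) := by
    calc _ ≤ ν (({z | l < ‖f z‖ ^ s / A} ∩ disc) ∪ discᶜ) := measure_mono fun z hz => by
          by_cases h : z ∈ disc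
          · exact Or.inl ⟨hz, h⟩
          · exact Or.inr h
      _ ≤ _ := (measure_union_le _ _).trans (by rw [hν0, add_zero])
  refine hle.trans ?_
  rw [← lintegral_indicator hTm]
  refine measure_le_of_forall_exists_region hr hν (by simpa using hl) ENNReal.ofReal_ne_top ?_
  rintro z ⟨hz, hzd⟩
  rw [mem_ofPred_eq, lt_div_iff₀ hApos] at hz
  have hex : ∃ b ∈ disc, z ∈ region b ∧
      ENNReal.ofReal l * mass w (1 - ‖b‖) < ∫⁻ ζ in region b, G ζ ∂radial w := by
    -- If all averages around `z` were at most `l`, the pointwise bound would give `|f(z)|^s / A ≤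
    -- l`.
    by_contra! hcon
    have := hw.rpow_le_of_forall_region hf hfm hs hN hzd hcon
    have hA' : (8 : ℝ≥0∞) * 2 ^ N * C = ENNReal.ofReal A := by
      rw [hA, ENNReal.ofReal_mul (by positivity), ENNReal.ofReal_mul (by positivity),
        ENNReal.ofReal_pow (by positivity)]
      simp
    rw [hA', ← ENNReal.ofReal_mul hApos.le, ENNReal.ofReal_le_ofReal_iff (by positivity)] at this
    linarith
  obtain ⟨b, hb, hzb, hlt⟩ := hex
  refine ⟨b, hb, hzb, ?_⟩
  have hfin : ENNReal.ofReal (l / 2) * mass w (1 - ‖b‖) ≠ ∞ :=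
    ENNReal.mul_ne_top ENNReal.ofReal_ne_top (hw.mass_ne_top _)
  refine ENNReal.le_of_add_le_add_left hfin ?_
  calc ENNReal.ofReal (l / 2) * mass w (1 - ‖b‖) + ENNReal.ofReal (l / 2) * mass w (1 - ‖b‖)
      = ENNReal.ofReal l * mass w (1 - ‖b‖) := by
        rw [← add_mul, ← ENNReal.ofReal_add (by positivity) (by positivity), add_halves]
    _ ≤ ∫⁻ ζ in region b, G ζ ∂radial w := hlt.le
    -- The part of `|f|^s` below `l / (16 C^2)` contributes at most half of `l` times the mass,
    -- since the region has measure at most `8 C^2` times the mass. The truncated function therefore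
    -- carries the other half.
    _ ≤ ∫⁻ ζ in region b, (ENNReal.ofReal (l / (16 * C ^ 2)) + T.indicator G ζ) ∂radial w := by
        refine lintegral_mono fun ζ => ?_
        by_cases hζ : ζ ∈ T
        · rw [indicator_of_mem hζ]; exact le_add_self
        · rw [indicator_of_notMem hζ, add_zero]
          exact ENNReal.ofReal_le_ofReal (not_lt.mp hζ)
    _ = ENNReal.ofReal (l / (16 * C ^ 2)) * radial w (region b) +
          ∫⁻ ζ in region b, T.indicator G ζ ∂radial w := by
        rw [lintegral_add_left measurable_const, setLIntegral_const]
    _ ≤ ENNReal.ofReal (l / (16 * C ^ 2)) * (8 * C ^ 2 * mass w (1 - ‖b‖)) +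
          ∫⁻ ζ in region b, T.indicator G ζ ∂radial w := by
        gcongr
        exact hw.radial_ball_le hb
    _ = _ := by
        rw [← mul_assoc]
        congr 2
        have : (8 : ℝ≥0∞) * C ^ 2 = ENNReal.ofReal (8 * C ^ 2) := by
          rw [ENNReal.ofReal_mul (by positivity), ENNReal.ofReal_pow (by positivity)]
          simp
        rw [this, ← ENNReal.ofReal_mul (by positivity)]
        congr 1
        field_simp
        norm_num

/-! ### The Carleson embedding. -/

/-- The Carleson embedding theorem in normalised form. -/
lemma DoublingDensity.lintegral_rpow_le {w : ℝ → ℝ≥0∞} {C : ℝ≥0} (hw : DoublingDensity w C)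
    {p q : ℝ} (hp : 0 < p) (hpq : p ≤ q) {N : ℕ} (hN : 2 * (C : ℝ≥0∞) ≤ 2 ^ N) :
    ∃ B : ℝ≥0, ∀ (f : ℂ → ℂ) (ν : Measure ℂ) (K : ℝ≥0∞), DifferentiableOn ℂ f disc →
      Measurable f → ν discᶜ = 0 →
      (∀ b ∈ disc, ν (Metric.ball b (12 * (1 - ‖b‖))) ≤ K * mass w (1 - ‖b‖) ^ (q / p)) →
      ∫⁻ z, ENNReal.ofReal (‖f z‖ ^ p) ∂radial w ≤ 1 →
      ∫⁻ z, ENNReal.ofReal (‖f z‖ ^ q) ∂ν ≤ B * K := by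
  have hC : (1 : ℝ) ≤ C := by exact_mod_cast hw.one_le
  set r := q / p with hr
  have hr1 : 1 ≤ r := (one_le_div hp).mpr hpq
  -- With this `s`, the weak type bound acts on `g = |f|^s` at exponent 1, while the norm of `f`
  -- controls `∫ g^2`.
  set s := p / 2 with hs
  have hs0 : 0 < s := by positivity
  set A : ℝ := 8 * 2 ^ N * C with hA
  have hApos : 0 < A := by positivity
  set D : ℝ := 16 * C ^ 2 with hD
  have hDpos : 0 < D := by positivity
  refine ⟨(A ^ (2 * r) * (2 * r) * (2 ^ r * D ^ (r - 1)) * D).toNNReal, ?_⟩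
  intro f ν K hf hfm hν0 hν hnorm
  set g : ℂ → ℝ := fun z => ‖f z‖ ^ s with hg
  have hgm : Measurable g := by fun_prop
  have hg0 : ∀ z, 0 ≤ g z := fun z => by positivity
  have hg2 : ∀ z, g z * g z = ‖f z‖ ^ p := by
    intro z
    rw [hg]
    simp only
    rw [← Real.rpow_add_of_nonneg (norm_nonneg _) hs0.le hs0.le, hs, add_halves]
  set I : ℝ → ℝ≥0∞ := fun l => ∫⁻ z in {z | l / D < g z}, ENNReal.ofReal (g z) ∂radial w with hI
  -- On the truncation set `g ≤ (D / l) g^2`.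
  have hIle : ∀ l, 0 < l → I l ≤ ENNReal.ofReal (D / l) := by
    intro l hl
    have h1 : ∫⁻ z in {z | l / D < g z}, ENNReal.ofReal (g z) ∂radial w ≤
        ∫⁻ z, ENNReal.ofReal (D / l) * ENNReal.ofReal (‖f z‖ ^ p) ∂radial w := by
      rw [← lintegral_indicator (measurableSet_lt measurable_const hgm)]
      refine lintegral_mono fun z => ?_
      by_cases hz : l / D < g z
      · rw [indicator_of_mem (show z ∈ {z | l / D < g z} from hz),
            ← ENNReal.ofReal_mul (by positivity), ← hg2]
        refine ENNReal.ofReal_le_ofReal ?_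
        rw [div_lt_iff₀ hDpos] at hz
        rw [div_mul_eq_mul_div, le_div_iff₀ hl]
        nlinarith [hg0 z]
      · rw [indicator_of_notMem (show z ∉ {z | l / D < g z} from hz)]
        exact zero_le
    refine h1.trans ?_
    rw [lintegral_const_mul' _ _ ENNReal.ofReal_ne_top]
    calc _ ≤ ENNReal.ofReal (D / l) * 1 := by gcongr
      _ = _ := mul_one _
  -- Integrating over levels below `D g` turns `∫ I` into `D ∫ g^2`.
  have hIint : ∫⁻ l in Ioi 0, I l ≤ ENNReal.ofReal D := by
    have hm : Measurable fun z => ENNReal.ofReal (g z) := hgm.ennreal_ofReal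
    have hset : ∀ l, I l = ((radial w).withDensity fun z => ENNReal.ofReal (g z)) {z | l < D * g z}
        := by
      intro l
      have : {z | l < D * g z} = {z | l / D < g z} := by
        ext z
        simp only [mem_ofPred_eq]
        rw [div_lt_iff₀ hDpos, mul_comm]
      rw [this, withDensity_apply _ (measurableSet_lt measurable_const hgm)]
    simp_rw [hset]
    rw [← lintegral_eq_lintegral_meas_lt _ (Filter.Eventually.of_forall fun z => mul_nonneg
        hDpos.le (hg0 z))
      (hgm.const_mul D).aemeasurable, lintegral_withDensity_eq_lintegral_mul _ hm (by fun_prop)]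
    calc _ = ∫⁻ z, ENNReal.ofReal D * ENNReal.ofReal (‖f z‖ ^ p) ∂radial w := by
          refine lintegral_congr fun z => ?_
          rw [Pi.mul_apply, ← ENNReal.ofReal_mul (hg0 z), ← ENNReal.ofReal_mul hDpos.le, ← hg2]
          congr 1; ring
      _ ≤ ENNReal.ofReal D * 1 := by
          rw [lintegral_const_mul' _ _ ENNReal.ofReal_ne_top]
          gcongr
      _ = _ := mul_one _
  have hpt : ∀ l ∈ Ioi (0 : ℝ), ν {z | l < g z / A} * ENNReal.ofReal (l ^ (2 * r - 1)) ≤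
      K * ENNReal.ofReal (2 ^ r * D ^ (r - 1)) * I l := by
    intro l hl
    have hl0 : 0 < l := hl
    -- One factor `I l` is kept for integration in `l`; the remaining power is bounded pointwise.
    -- The resulting powers of `l`, namely `-r`, `-(r - 1)` and `2r - 1`, cancel.
    have hIr : I l ^ r ≤ I l * ENNReal.ofReal ((D / l) ^ (r - 1)) := by
      conv_lhs => rw [show r = 1 + (r - 1) by ring]
      rw [ENNReal.rpow_add_of_nonneg _ _ zero_le_one (by linarith), ENNReal.rpow_one,
        ← ENNReal.ofReal_rpow_of_nonneg (by positivity) (by linarith)]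
      exact mul_le_mul' le_rfl (ENNReal.rpow_le_rpow (hIle l hl0) (by linarith))
    calc _ ≤ K * ((ENNReal.ofReal (l / 2))⁻¹ * I l) ^ r * ENNReal.ofReal (l ^ (2 * r - 1)) := by
          gcongr
          exact hw.measure_superlevel_le hf hfm hs0 hN hν0 hr1 hν hl0
      _ = K * (ENNReal.ofReal ((2 / l) ^ r) * I l ^ r) * ENNReal.ofReal (l ^ (2 * r - 1)) := by
          rw [ENNReal.mul_rpow_of_nonneg _ _ (by linarith),
              ← ENNReal.ofReal_inv_of_pos (by positivity),
            ENNReal.ofReal_rpow_of_nonneg (by positivity) (by linarith), inv_div]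
      _ ≤ K * (ENNReal.ofReal ((2 / l) ^ r) * (I l * ENNReal.ofReal ((D / l) ^ (r - 1)))) *
            ENNReal.ofReal (l ^ (2 * r - 1)) := by gcongr
      _ = K * (ENNReal.ofReal ((2 / l) ^ r) * ENNReal.ofReal ((D / l) ^ (r - 1)) *
            ENNReal.ofReal (l ^ (2 * r - 1))) * I l := by ring
      _ = _ := by
          rw [← ENNReal.ofReal_mul (by positivity), ← ENNReal.ofReal_mul (by positivity)]
          congr 3
          rw [Real.div_rpow (by positivity) hl0.le, Real.div_rpow (by positivity) hl0.le,
            show 2 * r - 1 = r + (r - 1) by ring, Real.rpow_add hl0]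
          field_simp
  have hq : ∀ z, ‖f z‖ ^ q = A ^ (2 * r) * (g z / A) ^ (2 * r) := by
    intro z
    rw [← Real.mul_rpow hApos.le (div_nonneg (hg0 z) hApos.le), mul_div_cancel₀ _ hApos.ne', hg]
    simp only
    rw [← Real.rpow_mul (norm_nonneg _), hs, hr]
    congr 1
    field_simp
  calc ∫⁻ z, ENNReal.ofReal (‖f z‖ ^ q) ∂ν
      = ENNReal.ofReal (A ^ (2 * r)) * ∫⁻ z, ENNReal.ofReal ((g z / A) ^ (2 * r)) ∂ν := by
        rw [← lintegral_const_mul' _ _ ENNReal.ofReal_ne_top]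
        refine lintegral_congr fun z => ?_
        rw [hq, ENNReal.ofReal_mul (by positivity)]
    _ = ENNReal.ofReal (A ^ (2 * r)) * (ENNReal.ofReal (2 * r) *
          ∫⁻ l in Ioi 0, ν {z | l < g z / A} * ENNReal.ofReal (l ^ (2 * r - 1))) := by
        rw [lintegral_rpow_eq_lintegral_meas_lt_mul ν
          (Filter.Eventually.of_forall fun z => div_nonneg (hg0 z) hApos.le)
          (hgm.div_const A).aemeasurable (by linarith)]
    _ ≤ ENNReal.ofReal (A ^ (2 * r)) * (ENNReal.ofReal (2 * r) *
          ∫⁻ l in Ioi 0, K * ENNReal.ofReal (2 ^ r * D ^ (r - 1)) * I l) := by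
        gcongr _ * (_ * ?_)
        exact setLIntegral_mono' measurableSet_Ioi hpt
    _ ≤ ENNReal.ofReal (A ^ (2 * r)) * (ENNReal.ofReal (2 * r) *
          (K * ENNReal.ofReal (2 ^ r * D ^ (r - 1)) * ENNReal.ofReal D)) := by
        gcongr _ * (_ * ?_)
        have hanti : Antitone I := by
          intro l l' hll
          refine lintegral_mono_set fun z hz => ?_
          refine lt_of_le_of_lt ?_ (show l' / D < g z from hz)
          gcongr
        rw [lintegral_const_mul _ hanti.measurable]
        gcongr
    _ = _ := by
        rw [← ENNReal.ofReal.eq_1, ENNReal.ofReal_mul (q := D) (by positivity),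
          ENNReal.ofReal_mul (q := 2 ^ r * D ^ (r - 1)) (by positivity),
          ENNReal.ofReal_mul (q := 2 * r) (by positivity)]
        ring

/-! ### Test functions. -/

lemma ofReal_norm_rpow {E : Type*} [SeminormedAddCommGroup E] (x : E) {t : ℝ} (ht : 0 ≤ t) :
    ENNReal.ofReal (‖x‖ ^ t) = ‖x‖ₑ ^ t := by
  rw [← ENNReal.ofReal_rpow_of_nonneg (norm_nonneg _) ht, ofReal_norm]

lemma eLpNorm_ofReal_rpow {f : ℂ → ℂ} {m : Measure ℂ} {t : ℝ} (ht : 0 < t) :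
    eLpNorm f (ENNReal.ofReal t) m ^ t = ∫⁻ z, ‖f z‖ₑ ^ t ∂m := by
  rw [eLpNorm_eq_lintegral_rpow_enorm_toReal (by simpa using ht) ENNReal.ofReal_ne_top,
    ENNReal.toReal_ofReal ht.le, one_div, ENNReal.rpow_inv_rpow ht.ne']

/-- The modulus of the base of the test function, `(1 - |a|²) / |1 - conj a * z|`. -/
def testBase (a z : ℂ) : ℝ := (1 - ‖a‖ ^ 2) / ‖1 - starRingEnd ℂ a * z‖

lemma testBase_nonneg {a z : ℂ} (ha : a ∈ disc) : 0 ≤ testBase a z := by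
  have : ‖a‖ < 1 := by simpa using ha
  exact div_nonneg (by nlinarith [norm_nonneg a]) (norm_nonneg _)

lemma testBase_le {a z : ℂ} (ha : a ∈ disc) : testBase a z ≤ 2 * decay a z := by
  have : ‖a‖ < 1 := by simpa using ha
  rw [testBase, decay, ← mul_div_assoc]
  gcongr
  nlinarith [norm_nonneg a]

/-- On this ball the denominator is at most `(1 - |b|^2) + |z - b| ≤ 14 (1 - |b|)`, while the
numerator is at least `1 - |b|`. -/
lemma le_testBase {b z : ℂ} (hb : b ∈ disc) (hz : z ∈ disc)
    (hzb : z ∈ Metric.ball b (12 * (1 - ‖b‖))) : 1 / 14 ≤ testBase b z := by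
  have hb1 : ‖b‖ < 1 := by simpa using hb
  have h0 := norm_pos_iff.mpr (one_sub_conj_mul_ne_zero hb hz)
  rw [Metric.mem_ball, dist_eq_norm] at hzb
  have h1 : ‖1 - starRingEnd ℂ b * z‖ ≤ 14 * (1 - ‖b‖) := by
    have e : 1 - starRingEnd ℂ b * z = ((1 - ‖b‖ ^ 2 : ℝ) : ℂ) - starRingEnd ℂ b * (z - b) := by
      rw [mul_sub, Complex.conj_mul']; push_cast; ring
    calc _ ≤ ‖((1 - ‖b‖ ^ 2 : ℝ) : ℂ)‖ + ‖starRingEnd ℂ b * (z - b)‖ := by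
            rw [e]
            exact norm_sub_le _ _
      _ = (1 - ‖b‖ ^ 2) + ‖b‖ * ‖z - b‖ := by
        rw [Complex.norm_real, Real.norm_of_nonneg (by nlinarith [norm_nonneg b]), norm_mul,
            RCLike.norm_conj]
      _ ≤ 14 * (1 - ‖b‖) := by nlinarith [norm_nonneg b, norm_nonneg (z - b)]
  rw [testBase, div_le_div_iff₀ (by norm_num) h0]
  nlinarith [norm_nonneg b]

lemma enorm_testFun_rpow {ω : ℝ → ℝ} {p γ : ℝ} {a z : ℂ} (ha : a ∈ disc)
    (hfin : weighted ω (carlesonSquare a) ≠ ∞) (hne : weighted ω (carlesonSquare a) ≠ 0)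
    {t : ℝ} (ht : 0 < t) :
    ‖testFun ω p γ a z‖ₑ ^ t = ENNReal.ofReal (testBase a z ^ ((γ + 1) / p * t)) *
      (weighted ω (carlesonSquare a) ^ (t / p))⁻¹ := by
  have ha1 : ‖a‖ < 1 := by simpa using ha
  have hb := testBase_nonneg (z := z) ha
  set σ := weighted ω (carlesonSquare a) with hσ
  have hσ0 : 0 < σ.toReal := ENNReal.toReal_pos hne hfin
  have hn : ‖testFun ω p γ a z‖ = testBase a z ^ ((γ + 1) / p) * (σ.toReal ^ (1 / p))⁻¹ := by
    rw [testFun, norm_mul, Complex.norm_cpow_real, norm_div, ← hσ, Complex.norm_real,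
      Real.norm_of_nonneg (by positivity), one_div (σ.toReal ^ (1 / p))]
    congr 3
    rw [← Complex.ofReal_one, ← Complex.ofReal_pow, ← Complex.ofReal_sub, Complex.norm_real,
      Real.norm_of_nonneg (by nlinarith [norm_nonneg a])]
  rw [← ofReal_norm, hn, ENNReal.ofReal_mul (by positivity), ENNReal.mul_rpow_of_nonneg _ _ ht.le,
    ENNReal.ofReal_rpow_of_nonneg (by positivity) ht.le, ← Real.rpow_mul hb,
    ENNReal.ofReal_inv_of_pos (by positivity), ← ENNReal.ofReal_rpow_of_pos hσ0,
    ENNReal.ofReal_toReal hfin, ENNReal.inv_rpow, ← ENNReal.rpow_mul]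
  congr 3
  ring

lemma measurable_testFun (ω : ℝ → ℝ) (p γ : ℝ) (a : ℂ) : Measurable (testFun ω p γ a) := by
  unfold testFun; fun_prop

lemma differentiableOn_testFun (ω : ℝ → ℝ) (p γ : ℝ) {a : ℂ} (ha : a ∈ disc) :
    DifferentiableOn ℂ (testFun ω p γ a) disc := by
  have ha1 : ‖a‖ < 1 := by simpa using ha
  intro z hz
  have hz1 : ‖z‖ < 1 := by simpa using hz
  have hne := one_sub_conj_mul_ne_zero ha hz
  refine DifferentiableAt.differentiableWithinAt ?_
  refine DifferentiableAt.mul_const ?_ _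
  refine DifferentiableAt.cpow_const (DifferentiableAt.div (by fun_prop) (by fun_prop) hne) ?_
  have hre : 0 < (1 - starRingEnd ℂ a * z).re := by
    have h1 : (starRingEnd ℂ a * z).re ≤ ‖a‖ * ‖z‖ := by
      have := Complex.re_le_norm (starRingEnd ℂ a * z)
      rwa [norm_mul, RCLike.norm_conj] at this
    rw [Complex.sub_re, Complex.one_re]
    nlinarith [norm_nonneg a]
  refine Or.inl ?_
  rw [← Complex.ofReal_one, ← Complex.ofReal_pow, ← Complex.ofReal_sub, div_eq_mul_inv,
    Complex.re_ofReal_mul, Complex.inv_re]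
  refine mul_pos (by nlinarith [norm_nonneg a]) (div_pos (by simpa using hre) ?_)
  simpa using hne

/-- Since the kernel is at most 1 and `N ≤ γ + 1`, `|F_a|^p` is dominated by its `N`-th power. The
dyadic estimate with the constant function 1 bounds the integral by the mass, which the
normalisation by `ω(S(a))` cancels. -/
lemma lintegral_testFun_le {ω : ℝ → ℝ} {w : ℝ → ℝ≥0∞} {C : ℝ≥0} (hw : DoublingDensity w C)
    (hωw : weighted ω = radial w) {p γ : ℝ} (hp : 0 < p) {N : ℕ} (hN : 2 * (C : ℝ≥0∞) ≤ 2 ^ N)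
    (hγ : N ≤ γ + 1) {a : ℂ} (ha : a ∈ disc) :
    ∫⁻ z, ‖testFun ω p γ a z‖ₑ ^ p ∂weighted ω ≤ ENNReal.ofReal (2 ^ (γ + 1)) * (256 * C ^ 3) := by
  have ha1 : ‖a‖ < 1 := by simpa using ha
  have hlow := hw.mass_le_radial_carlesonSquare ha
  have hup := hw.radial_carlesonSquare_le ha
  have hm0 := hw.mass_ne_zero (1 - ‖a‖) (by linarith)
  rw [← hωw] at hlow hup
  set σ := weighted ω (carlesonSquare a) with hσ
  have hσ0 : σ ≠ 0 := by
    intro h; rw [h, mul_zero] at hlow; exact hm0 (le_antisymm hlow zero_le)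
  have hσt : σ ≠ ∞ :=
    ne_top_of_le_ne_top (ENNReal.mul_ne_top ENNReal.ofNat_ne_top (hw.mass_ne_top _)) hup
  have hdec := lintegral_decay_pow_le hw hN (ae_mem_disc_radial w) (g := fun _ => 1)
      measurable_const ha
    (l := 8 * C ^ 2) (fun b hb _ => by simpa [region] using hw.radial_ball_le hb)
  have hγ0 : 0 ≤ γ + 1 := (Nat.cast_nonneg N).trans hγ
  calc ∫⁻ z, ‖testFun ω p γ a z‖ₑ ^ p ∂weighted ω
      ≤ ∫⁻ z, ENNReal.ofReal (2 ^ (γ + 1)) * σ⁻¹ * (1 * ENNReal.ofReal (decay a z ^ N)) ∂radial w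
          := by
        rw [hωw]
        refine lintegral_mono_ae ?_
        filter_upwards [ae_mem_disc_radial w] with z hz
        rw [enorm_testFun_rpow ha hσt hσ0 hp, div_self hp.ne', ENNReal.rpow_one, one_mul, ← hσ,
          div_mul_cancel₀ _ hp.ne']
        have hdpos : 0 < decay a z := div_pos (by linarith)
          (norm_pos_iff.mpr (one_sub_conj_mul_ne_zero ha hz))
        have hd0 := hdpos.le
        have hd1 : decay a z ≤ 1 := div_le_one_of_le₀ (one_sub_norm_le hz) (norm_nonneg _)
        have : testBase a z ^ (γ + 1) ≤ 2 ^ (γ + 1) * decay a z ^ N := by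
          calc _ ≤ (2 * decay a z) ^ (γ + 1) :=
                Real.rpow_le_rpow (testBase_nonneg ha) (testBase_le ha) hγ0
            _ = 2 ^ (γ + 1) * decay a z ^ (γ + 1) := Real.mul_rpow (by norm_num) hd0
            _ ≤ 2 ^ (γ + 1) * decay a z ^ N := by
              gcongr
              rw [← Real.rpow_natCast]
              exact Real.rpow_le_rpow_of_exponent_ge hdpos hd1 hγ
        calc _ ≤ ENNReal.ofReal (2 ^ (γ + 1) * decay a z ^ N) * σ⁻¹ := by gcongr
          _ = _ := by rw [ENNReal.ofReal_mul (by positivity)]; ring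
    _ ≤ ENNReal.ofReal (2 ^ (γ + 1)) * σ⁻¹ * (2 * (8 * C ^ 2) * mass w (1 - ‖a‖)) := by
        rw [lintegral_const_mul' _ _ (ENNReal.mul_ne_top ENNReal.ofReal_ne_top
            (ENNReal.inv_ne_top.mpr hσ0))]
        gcongr
    _ ≤ ENNReal.ofReal (2 ^ (γ + 1)) * σ⁻¹ * (2 * (8 * C ^ 2) * (16 * C * σ)) := by gcongr
    _ = ENNReal.ofReal (2 ^ (γ + 1)) * (256 * C ^ 3) * (σ⁻¹ * σ) := by ring
    _ = _ := by rw [ENNReal.inv_mul_cancel hσ0 hσt, mul_one]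

/-! ### The pulled-back measure and the two inequalities. -/

/-- The image under `φ` of the measure `|u|^q dμ` on the disc. -/
def pullbackMeasure (q : ℝ) (μ : Measure ℂ) (u φ : ℂ → ℂ) : Measure ℂ :=
  ((μ.restrict disc).withDensity fun z => ‖u z‖ₑ ^ q).map φ

section pullback

variable {q : ℝ} {μ : Measure ℂ} {u φ : ℂ → ℂ}

lemma aemeasurable_of_differentiableOn_disc (hφ : DifferentiableOn ℂ φ disc) :
    AEMeasurable φ (μ.restrict disc) :=
  hφ.continuousOn.aemeasurable Metric.isOpen_ball.measurableSet

lemma lintegral_pullbackMeasure (hu : Measurable fun z : disc => u z)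
    (hφ : DifferentiableOn ℂ φ disc) {F : ℂ → ℝ≥0∞} (hF : Measurable F) :
    ∫⁻ z, F z ∂pullbackMeasure q μ u φ = ∫⁻ z in disc, F (φ z) * ‖u z‖ₑ ^ q ∂μ := by
  have hum : AEMeasurable u (μ.restrict disc) :=
    aemeasurable_restrict_of_measurable_subtype Metric.isOpen_ball.measurableSet hu
  have hφm : AEMeasurable φ (μ.restrict disc) := aemeasurable_of_differentiableOn_disc hφ
  rw [pullbackMeasure, lintegral_map' hF.aemeasurable
    (hφm.mono_ac (withDensity_absolutelyContinuous _ _)),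
    lintegral_withDensity_eq_lintegral_mul₀ (g := fun z => F (φ z)) (hum.enorm.pow_const q)
      (hF.comp_aemeasurable hφm)]
  refine lintegral_congr fun z => ?_
  rw [Pi.mul_apply, mul_comm]

lemma pullbackMeasure_compl_disc (hu : Measurable fun z : disc => u z)
    (hφ : DifferentiableOn ℂ φ disc) (hmaps : MapsTo φ disc disc) :
    pullbackMeasure q μ u φ discᶜ = 0 := by
  have hm : MeasurableSet discᶜ := Metric.isOpen_ball.measurableSet.compl
  rw [← lintegral_indicator_one hm, lintegral_pullbackMeasure hu hφ (measurable_one.indicator hm),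
    setLIntegral_congr_fun (g := fun _ => 0) Metric.isOpen_ball.measurableSet]
  · simp
  · intro z hz
    simp only
    rw [indicator_of_notMem (notMem_compl_iff.mpr (hmaps hz)), zero_mul]

end pullback

/-- Testing with the single function `F_b` suffices: its modulus is bounded below on the ball. This
is the Carleson condition required by the embedding. -/
lemma pullbackMeasure_ball_le {ω : ℝ → ℝ} {w : ℝ → ℝ≥0∞} {C : ℝ≥0} (hw : DoublingDensity w C)
    (hωw : weighted ω = radial w) {p q γ : ℝ} (hp : 0 < p) (hq : 0 < q) (hγ : 0 < γ)
    {u φ : ℂ → ℂ} {μ : Measure ℂ} (hu : Measurable fun z : disc => u z)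
    (hφ : DifferentiableOn ℂ φ disc) (hmaps : MapsTo φ disc disc) {b : ℂ} (hb : b ∈ disc) :
    pullbackMeasure q μ u φ (Metric.ball b (12 * (1 - ‖b‖))) ≤
      ENNReal.ofReal (14 ^ ((γ + 1) / p * q)) * 2 ^ (q / p) * testSup ω p q γ μ u φ *
        mass w (1 - ‖b‖) ^ (q / p) := by
  have hb1 : ‖b‖ < 1 := by simpa using hb
  have hlow := hw.mass_le_radial_carlesonSquare hb
  have hup := hw.radial_carlesonSquare_le hb
  have hm0 := hw.mass_ne_zero (1 - ‖b‖) (by linarith)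
  rw [← hωw] at hlow hup
  set σ := weighted ω (carlesonSquare b) with hσ
  have hσ0 : σ ≠ 0 := by
    intro h; rw [h, mul_zero] at hlow; exact hm0 (le_antisymm hlow zero_le)
  have hσt : σ ≠ ∞ :=
    ne_top_of_le_ne_top (ENNReal.mul_ne_top ENNReal.ofNat_ne_top (hw.mass_ne_top _)) hup
  have hr : 0 < q / p := by positivity
  set e := (γ + 1) / p * q with he
  have he0 : 0 < e := by positivity
  set ν := pullbackMeasure q μ u φ with hν
  set X := Metric.ball b (12 * (1 - ‖b‖)) with hX
  have hXm : MeasurableSet (X ∩ disc) := Metric.isOpen_ball.measurableSet.inter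
      Metric.isOpen_ball.measurableSet
  have hν0 := pullbackMeasure_compl_disc (q := q) (μ := μ) hu hφ hmaps
  have hXd : ν X ≤ ν (X ∩ disc) := by
    calc ν X ≤ ν ((X ∩ disc) ∪ discᶜ) := measure_mono fun z hz => by
          by_cases h : z ∈ disc
          · exact Or.inl ⟨hz, h⟩
          · exact Or.inr h
      _ ≤ _ := (measure_union_le _ _).trans (by rw [hν0, add_zero])
  have hmain : ENNReal.ofReal ((1 / 14) ^ e) * (σ ^ (q / p))⁻¹ * ν (X ∩ disc) ≤ testSup ω p q γ μ u
      φ := by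
    calc _ = ∫⁻ z in X ∩ disc, ENNReal.ofReal ((1 / 14) ^ e) * (σ ^ (q / p))⁻¹ ∂ν := by
          rw [setLIntegral_const]
      _ ≤ ∫⁻ z in X ∩ disc, ‖testFun ω p γ b z‖ₑ ^ q ∂ν := by
          refine setLIntegral_mono' hXm fun z hz => ?_
          rw [enorm_testFun_rpow hb hσt hσ0 hq]
          gcongr
          exact le_testBase hb hz.2 hz.1
      _ ≤ ∫⁻ z, ‖testFun ω p γ b z‖ₑ ^ q ∂ν := setLIntegral_le_lintegral _ _
      _ = ∫⁻ z in disc, ‖testFun ω p γ b (φ z)‖ₑ ^ q * ‖u z‖ₑ ^ q ∂μ :=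
          lintegral_pullbackMeasure hu hφ ((measurable_testFun ω p γ b).enorm.pow_const q)
      _ ≤ _ := le_iSup₂_of_le b hb le_rfl
  have h14 : ENNReal.ofReal (14 ^ e) * ENNReal.ofReal ((1 / 14) ^ e) = 1 := by
    rw [← ENNReal.ofReal_mul (by positivity), ← Real.mul_rpow (by norm_num) (by norm_num)]
    norm_num
  have hσr : σ ^ (q / p) * (σ ^ (q / p))⁻¹ = 1 :=
    ENNReal.mul_inv_cancel (by simp [hσ0, hr.not_gt]) (ENNReal.rpow_ne_top_of_nonneg hr.le hσt)
  calc ν X ≤ ν (X ∩ disc) := hXd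
    _ = (ENNReal.ofReal (14 ^ e) * ENNReal.ofReal ((1 / 14) ^ e)) * (σ ^ (q / p) * (σ ^ (q / p))⁻¹)
        *
          ν (X ∩ disc) := by rw [h14, hσr, one_mul, one_mul]
    _ = ENNReal.ofReal (14 ^ e) * σ ^ (q / p) *
          (ENNReal.ofReal ((1 / 14) ^ e) * (σ ^ (q / p))⁻¹ * ν (X ∩ disc)) := by ring
    _ ≤ ENNReal.ofReal (14 ^ e) * (2 * mass w (1 - ‖b‖)) ^ (q / p) * testSup ω p q γ μ u φ := by
        gcongr
    _ = _ := by rw [ENNReal.mul_rpow_of_nonneg _ _ hr.le]; ring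

lemma lintegral_wcomp {q : ℝ} (hq : 0 < q) {μ : Measure ℂ} {u φ f : ℂ → ℂ} :
    eLpNorm (wcomp u φ f) (ENNReal.ofReal q) (μ.restrict disc) ^ q =
      ∫⁻ z in disc, ‖f (φ z)‖ₑ ^ q * ‖u z‖ₑ ^ q ∂μ := by
  rw [eLpNorm_ofReal_rpow hq]
  refine lintegral_congr fun z => ?_
  rw [wcomp, enorm_mul, ENNReal.mul_rpow_of_nonneg _ _ hq.le, mul_comm]

lemma wcompNorm_rpow_le {ω : ℝ → ℝ} {w : ℝ → ℝ≥0∞} {C : ℝ≥0} (hw : DoublingDensity w C)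
    (hωw : weighted ω = radial w) {p q γ : ℝ} (hp : 0 < p) (hpq : p ≤ q) (hγ : 0 < γ) {N : ℕ}
    (hN : 2 * (C : ℝ≥0∞) ≤ 2 ^ N) :
    ∃ B : ℝ≥0, ∀ (u φ : ℂ → ℂ) (μ : Measure ℂ), Measurable (fun z : disc => u z) →
      DifferentiableOn ℂ φ disc → MapsTo φ disc disc →
      wcompNorm ω p q μ u φ ^ q ≤ B * testSup ω p q γ μ u φ := by
  have hq : 0 < q := hp.trans_le hpq
  obtain ⟨B, hB⟩ := hw.lintegral_rpow_le hp hpq hN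
  refine ⟨B * (((14 : ℝ) ^ ((γ + 1) / p * q)).toNNReal * 2 ^ (q / p)), fun u φ μ hu hφ hmaps => ?_⟩
  rw [← ENNReal.le_rpow_inv_iff hq]
  refine iSup₂_le fun f hf => ?_
  rw [ENNReal.le_rpow_inv_iff hq, lintegral_wcomp hq]
  obtain ⟨⟨hfd, -⟩, hf1⟩ := hf
  -- Members of the space are arbitrary off the disc; cutting off gives measurability and changes
  -- neither side, since `φ` maps the disc into itself.
  set f' : ℂ → ℂ := disc.indicator f with hf'
  have heq : EqOn f' f disc := fun z hz => indicator_of_mem hz f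
  have hfm : Measurable f' := by
    classical
    rw [hf', ← piecewise_eq_indicator]
    exact hfd.continuousOn.measurable_piecewise continuousOn_const Metric.isOpen_ball.measurableSet
  have hnorm : ∫⁻ z, ENNReal.ofReal (‖f' z‖ ^ p) ∂radial w ≤ 1 := by
    calc _ = ∫⁻ z, ‖f z‖ₑ ^ p ∂weighted ω := by
          rw [hωw]
          refine lintegral_congr_ae ?_
          filter_upwards [ae_mem_disc_radial w] with z hz
          rw [ofReal_norm_rpow _ hp.le, heq hz]
      _ = bergmanNorm ω p f ^ p := (eLpNorm_ofReal_rpow hp).symm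
      _ ≤ 1 := ENNReal.rpow_le_one hf1 hp.le
  have hmain := hB f' (pullbackMeasure q μ u φ) _ (hfd.congr heq) hfm
    (pullbackMeasure_compl_disc hu hφ hmaps)
    (fun b hb => pullbackMeasure_ball_le hw hωw hp hq hγ hu hφ hmaps hb) hnorm
  rw [lintegral_pullbackMeasure hu hφ (by fun_prop)] at hmain
  calc _ = ∫⁻ z in disc, ENNReal.ofReal (‖f' (φ z)‖ ^ q) * ‖u z‖ₑ ^ q ∂μ := by
        refine setLIntegral_congr_fun Metric.isOpen_ball.measurableSet fun z hz => ?_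
        rw [ofReal_norm_rpow _ hq.le, heq (hmaps hz)]
    _ ≤ _ := hmain
    _ = _ := by
        rw [ENNReal.coe_mul, ENNReal.coe_mul, ENNReal.coe_rpow_of_nonneg _ (by positivity),
          ENNReal.coe_ofNat, ← ENNReal.ofReal.eq_1]
        ring

lemma testSup_le {ω : ℝ → ℝ} {w : ℝ → ℝ≥0∞} {C : ℝ≥0} (hw : DoublingDensity w C)
    (hωw : weighted ω = radial w) {p q γ : ℝ} (hp : 0 < p) (hq : 0 < q) {N : ℕ}
    (hN : 2 * (C : ℝ≥0∞) ≤ 2 ^ N) (hγ : N ≤ γ + 1) :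
    ∃ B : ℝ≥0, ∀ (u φ : ℂ → ℂ) (μ : Measure ℂ),
      testSup ω p q γ μ u φ ≤ B * wcompNorm ω p q μ u φ ^ q := by
  have hC : (1 : ℝ) ≤ C := by exact_mod_cast hw.one_le
  set M : ℝ := 2 ^ (γ + 1) * (256 * C ^ 3) with hM
  have hMpos : 0 < M := by positivity
  have hMe : ENNReal.ofReal (2 ^ (γ + 1)) * (256 * C ^ 3) = ENNReal.ofReal M := by
    rw [hM, ENNReal.ofReal_mul (by positivity), ENNReal.ofReal_mul (by norm_num),
      ENNReal.ofReal_pow (by positivity)]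
    simp
  refine ⟨(M ^ (q / p)).toNNReal, fun u φ μ => iSup₂_le fun a ha => ?_⟩
  -- `M` bounds `∫ |F_a|^p` uniformly in `a`, so `c F_a` lies in the unit ball.
  set c : ℝ := (M ^ (1 / p))⁻¹ with hc
  have hcpos : 0 < c := by positivity
  set f : ℂ → ℂ := fun z => (c : ℂ) * testFun ω p γ a z with hf
  have hen : ∀ (t : ℝ), 0 < t → ∀ z,
      ‖f z‖ₑ ^ t = ENNReal.ofReal (M ^ (t / p))⁻¹ * ‖testFun ω p γ a z‖ₑ ^ t := by
    intro t ht z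
    rw [hf]
    simp only
    rw [enorm_mul, ENNReal.mul_rpow_of_nonneg _ _ ht.le, ← ofReal_norm (c : ℂ), Complex.norm_real,
      Real.norm_of_nonneg hcpos.le, ENNReal.ofReal_rpow_of_nonneg hcpos.le ht.le, hc,
      Real.inv_rpow (by positivity), ← Real.rpow_mul hMpos.le]
    congr 4
    ring
  have hnorm : bergmanNorm ω p f ≤ 1 := by
    rw [← ENNReal.rpow_le_rpow_iff hp, ENNReal.one_rpow, bergmanNorm, eLpNorm_ofReal_rpow hp]
    calc _ = ENNReal.ofReal M⁻¹ * ∫⁻ z, ‖testFun ω p γ a z‖ₑ ^ p ∂weighted ω := by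
          rw [← lintegral_const_mul' _ _ ENNReal.ofReal_ne_top]
          refine lintegral_congr fun z => ?_
          rw [hen p hp, div_self hp.ne', Real.rpow_one]
      _ ≤ ENNReal.ofReal M⁻¹ * ENNReal.ofReal M := by
          gcongr
          rw [← hMe]
          exact lintegral_testFun_le hw hωw hp hN hγ ha
      _ = 1 := by
          rw [← ENNReal.ofReal_mul (by positivity), inv_mul_cancel₀ hMpos.ne', ENNReal.ofReal_one]
  have hmem : f ∈ {f ∈ bergmanSpace ω p | bergmanNorm ω p f ≤ 1} :=
    ⟨⟨(differentiableOn_testFun ω p γ ha).const_mul _, hnorm.trans_lt ENNReal.one_lt_top⟩, hnorm⟩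
  calc ∫⁻ z in disc, ‖testFun ω p γ a (φ z)‖ₑ ^ q * ‖u z‖ₑ ^ q ∂μ
      = ENNReal.ofReal (M ^ (q / p)) * ∫⁻ z in disc, ‖f (φ z)‖ₑ ^ q * ‖u z‖ₑ ^ q ∂μ := by
        rw [← lintegral_const_mul' _ _ ENNReal.ofReal_ne_top]
        refine lintegral_congr fun z => ?_
        rw [hen q hq, ← mul_assoc, ← mul_assoc, ← ENNReal.ofReal_mul (by positivity),
          mul_inv_cancel₀ (by positivity), ENNReal.ofReal_one, one_mul]
    _ = ENNReal.ofReal (M ^ (q / p)) *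
          eLpNorm (wcomp u φ f) (ENNReal.ofReal q) (μ.restrict disc) ^ q := by rw [lintegral_wcomp
              hq]
    _ ≤ ENNReal.ofReal (M ^ (q / p)) * wcompNorm ω p q μ u φ ^ q := by
        gcongr
        exact le_iSup₂_of_le f hmem le_rfl

end WeightedBergman

end

theorem theorem1 (ω : ℝ → ℝ) (hω : WeightedBergman.IsDoubling ω) (p : ℝ) (hp : 0 < p) :
    ∃ γ₀ : ℝ, 0 < γ₀ ∧ ∀ γ : ℝ, γ₀ < γ → ∀ q : ℝ, p ≤ q →
      ∃ C : ℝ≥0, 0 < C ∧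
        ∀ (u φ : ℂ → ℂ) (μ : Measure ℂ),
          Measurable (fun z : WeightedBergman.disc => u z) →
          DifferentiableOn ℂ φ WeightedBergman.disc →
          MapsTo φ WeightedBergman.disc WeightedBergman.disc →
          WeightedBergman.wcompNorm ω p q μ u φ ^ q
              ≤ C * WeightedBergman.testSup ω p q γ μ u φ ∧
            WeightedBergman.testSup ω p q γ μ u φ
              ≤ C * WeightedBergman.wcompNorm ω p q μ u φ ^ q := by
  obtain ⟨w, C, hw, hωw⟩ := WeightedBergman.exists_doublingDensity hω
  obtain ⟨N, hN⟩ := pow_unbounded_of_one_lt (2 * C) (one_lt_two (α := ℝ≥0))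
  have hN' : 2 * (C : ℝ≥0∞) ≤ 2 ^ N := by exact_mod_cast hN.le
  -- The threshold comes from the doubling constant through `2C ≤ 2^N`; it makes `γ` positive and
  -- gives `N ≤ γ + 1`.
  refine ⟨N + 1, by positivity, fun γ hγ q hpq => ?_⟩
  have hN0 : (0 : ℝ) ≤ N := N.cast_nonneg
  have hq : 0 < q := hp.trans_le hpq
  obtain ⟨B₁, hB₁⟩ := WeightedBergman.wcompNorm_rpow_le hw hωw hp hpq
    (show 0 < γ by linarith) hN'
  obtain ⟨B₂, hB₂⟩ := WeightedBergman.testSup_le hw hωw hp hq hN' (show (N : ℝ) ≤ γ + 1 by linarith)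
  refine ⟨B₁ + B₂ + 1, by positivity, fun u φ μ hu hφ hmaps => ⟨?_, ?_⟩⟩
  · refine (hB₁ u φ μ hu hφ hmaps).trans (mul_le_mul' ?_ le_rfl)
    exact_mod_cast (show B₁ ≤ B₁ + B₂ + 1 by rw [add_assoc]; exact le_self_add)
  · refine (hB₂ u φ μ).trans (mul_le_mul' ?_ le_rfl)
    exact_mod_cast (show B₂ ≤ B₁ + B₂ + 1 by rw [add_right_comm]; exact le_add_self)
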